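/- Let $T>0$, $s_0>0$, $\sigma>0$, $\mu\in\mathbb{R}$. Let $(\Omega,\mathcal F,\mathbf P)$ be a complete probability space with a standard Brownian motion $W=(W_t)_{t\in[0,T]}$ (with a.s. continuous paths), let $$S_t=s_0\,e^{\mu t+\sigma W_t-\frac12\sigma^2t},\qquad t\in[0,T],$$ be the discounted Black--Scholes stock price, and let $(\mathcal F_t)_{t\in[0,T]}$ be the filtration generated by $S$, augmented by the null sets and made right-continuous. A portfolio is an adapted pair $\mathbf\Phi=(\Phi^0,\Phi)$ (bonds, shares) with value $V_t(\mathbf\Phi)=\Phi^0_t+\Phi_tS_t$. It is *almost simple* if there are nondecreasing $[0,T]$-valued stopping times $(\tau_k)_{k\ge0}$ with $\mathbf P[\exists k:\tau_k=T]=1$, an $\mathbb N$-valued random variable $N$ and $\mathcal F_{\tau_k}$-measurable $\phi_k,\phi^0_k$ such that a.s. $\Phi_t=\sum_{k=0}^{N-1}\phi_k\mathbf 1_{(\tau_k,\tau_{k+1}]}(t)$ and $\Phi^0_t=\sum_{k=0}^{N-1}\phi^0_k\mathbf 1_{(\tau_k,\tau_{k+1}]}(t)$ for all $t\in[0,T]$.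 It is *simple* if this holds with a deterministic $N=n$ and finitely many stopping times $0\le\tau_0\le\dots\le\tau_n\le T$, continued by $\tau_k=T$ for $k>n$. Such a portfolio is *self-financing* if, for all $k$, a.s. $V_{\tau_{k+1}}(\mathbf\Phi)-V_{\tau_k}(\mathbf\Phi)=\Phi_{\tau_{k+1}}(S_{\tau_{k+1}}-S_{\tau_k})$. Let $\mathcal A^{\mathrm{si}}$ and $\mathcal A^{\mathrm{as}}$ be the classes of self-financing simple and almost simple portfolios. A portfolio with $V_0(\mathbf\Phi)=0$ is *arbitrage* if $V_T(\mathbf\Phi)\ge0$ a.s. and $\mathbf P[V_T(\mathbf\Phi)>0]>0$, and *strong arbitrage* if $V_T(\mathbf\Phi)\ge a$ a.s. for some constant $a>0$. A sequence $(\mathbf\Phi^n)$ with $V_0(\mathbf\Phi^n)=0$ for all $n$ is *approximate arbitrage* if $V_T(\mathbf\Phi^n)$ converges in probability to some $V_T^\infty$ with $V^\infty_T\ge0$ a.s. and $\mathbf P[V^\infty_T>0]>0$; it is *strong* approximate arbitrage if moreover $V^\infty_T\ge a$ a.s. for some constant $a>0$. Then: 1. there is no arbitrage in $\mathcal A^{\mathrm{si}}$;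 2. there is strong approximate arbitrage in $\mathcal A^{\mathrm{si}}$, that is, by a sequence of portfolios in $\mathcal A^{\mathrm{si}}$; 3. there is strong arbitrage in $\mathcal A^{\mathrm{as}}$; 4. the arbitrages in 2 and 3 are given by a doubling strategy: with $t_k=T(1-2^{-k})$, there are constants $c_k>0$ such that, for $$\tau=\inf\Big\{t_k:\ k\ge1,\ \frac{S_{t_k}-S_{t_{k-1}}}{S_{t_{k-1}}}\ge c_k\Big\}\quad(\inf\emptyset:=T),$$ there is a strong arbitrage $\mathbf\Phi\in\mathcal A^{\mathrm{as}}$ with $$\Phi_t=\sum_{k=0}^\infty\phi_{t_k}\mathbf 1_{(t_k\wedge\tau,\,t_{k+1}\wedge\tau]}(t),\qquad \phi_{t_k}=\frac{1-V_{t_k}(\mathbf\Phi)}{S_{t_k}c_{k+1}},$$ and portfolios $\mathbf\Phi^n\in\mathcal A^{\mathrm{si}}$ with $\Phi^n_t=\sum_{k=0}^n\phi_{t_k}\mathbf 1_{(t_k\wedge\tau,\,t_{k+1}\wedge\tau]}(t)$ that form a strong approximate arbitrage. -/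

import Mathlib

open MeasureTheory ProbabilityTheory Filter Set
open scoped Topology

namespace BlackScholes

variable {Ω : Type*} {m : MeasurableSpace Ω} {T : ℝ}

/-- The trading period `[0, T]`. -/
abbrev Time (T : ℝ) : Type := Set.Icc (0 : ℝ) T

/-- The initial time `0`. -/
def initialTime (hT : 0 ≤ T) : Time T := ⟨0, le_rfl, hT⟩

/-- The maturity `T`. -/
def maturity (hT : 0 ≤ T) : Time T := ⟨T, hT, le_rfl⟩

/-! ### The model -/

/-- `W` is a standard Brownian motion on `[0, T]`: a centered Gaussian process with `W 0 = 0`,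
covariance `min s t`, and almost surely continuous paths. -/
structure IsBrownianMotion (P : Measure Ω) (hT : 0 ≤ T) (W : Time T → Ω → ℝ) : Prop where
  measurable : ∀ t, Measurable (W t)
  gaussian : IsGaussianProcess W P
  zero : ∀ᵐ ω ∂P, W (initialTime hT) ω = 0
  centered : ∀ t, ∫ ω, W t ω ∂P = 0
  covariance : ∀ s t, cov[W s, W t; P] = min (s : ℝ) (t : ℝ)
  continuous : ∀ᵐ ω ∂P, Continuous fun t => W t ω

/-- The discounted stock price `S_t = s₀ exp(μ t + σ W_t - σ² t / 2)`. -/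
noncomputable def price (s₀ μ σ : ℝ) (W : Time T → Ω → ℝ) (t : Time T) (ω : Ω) : ℝ :=
  s₀ * Real.exp (μ * t + σ * W t ω - σ ^ 2 * t / 2)

theorem measurable_price (s₀ μ σ : ℝ) {W : Time T → Ω → ℝ} (hW : ∀ t, Measurable (W t))
    (t : Time T) : Measurable (price s₀ μ σ W t) := by
  have := hW t
  unfold price
  fun_prop

/-- The usual augmentation of a filtration: adjoin all null sets, then make it right-continuous
(at the final time `T` nothing is changed by the second step). -/
noncomputable def usualAugmentation (P : Measure Ω) [P.IsComplete]
    (𝓖 : Filtration (Time T) m) : Filtration (Time T) m :=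
  (𝓖 ⊔ Filtration.const (Time T) (MeasurableSpace.generateFrom {s : Set Ω | P s = 0})
    (MeasurableSpace.generateFrom_le fun s hs => Measure.IsComplete.out' s hs)).rightCont

/-- The filtration generated by the stock price, augmented to satisfy the usual conditions. -/
noncomputable def priceFiltration (P : Measure Ω) [P.IsComplete] (s₀ μ σ : ℝ)
    (W : Time T → Ω → ℝ) (hW : ∀ t, Measurable (W t)) : Filtration (Time T) m :=
  usualAugmentation P
    (Filtration.natural (price s₀ μ σ W) fun t => (measurable_price s₀ μ σ hW t).stronglyMeasurable)

/-! ### Portfolios -/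

/-- A portfolio: an adapted pair (number of bonds, number of shares). -/
structure Portfolio (𝓕 : Filtration (Time T) m) where
  bond : Time T → Ω → ℝ
  stock : Time T → Ω → ℝ
  adapted_bond : Adapted 𝓕 bond
  adapted_stock : Adapted 𝓕 stock

variable {𝓕 : Filtration (Time T) m}

/-- The value `V_t(Φ) = Φ⁰_t + Φ_t S_t`. -/
def Portfolio.value (Φ : Portfolio 𝓕) (S : Time T → Ω → ℝ) (t : Time T) (ω : Ω) : ℝ :=
  Φ.bond t ω + Φ.stock t ω * S t ω

/-- Both components of `Φ` are of the form `∑_{k < N} φ_k 1_{(τ_k, τ_{k+1}]}` for nondecreasing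
`[0, T]`-valued stopping times `τ_k` and `𝓕_{τ_k}`-measurable `φ_k`. -/
def Portfolio.IsStepAlong (Φ : Portfolio 𝓕) (P : Measure Ω) (τ : ℕ → Ω → Time T)
    (N : Ω → ℕ) : Prop :=
  (∀ ω, Monotone fun k => τ k ω) ∧
  ∃ hτ : ∀ k, IsStoppingTime 𝓕 (fun ω => (τ k ω : WithTop (Time T))),
  ∃ φ₀ φ : ℕ → Ω → ℝ,
    (∀ k, Measurable[(hτ k).measurableSpace] (φ₀ k)) ∧
    (∀ k, Measurable[(hτ k).measurableSpace] (φ k)) ∧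
    (∀ᵐ ω ∂P, ∀ t, Φ.bond t ω =
      ∑ k ∈ Finset.range (N ω), (Set.Ioc (τ k ω) (τ (k + 1) ω)).indicator (fun _ => φ₀ k ω) t) ∧
    (∀ᵐ ω ∂P, ∀ t, Φ.stock t ω =
      ∑ k ∈ Finset.range (N ω), (Set.Ioc (τ k ω) (τ (k + 1) ω)).indicator (fun _ => φ k ω) t)

/-- The self-financing condition along the readjustment times `τ_k`. -/
def Portfolio.IsSelfFinancingAlong (Φ : Portfolio 𝓕) (P : Measure Ω) (S : Time T → Ω → ℝ)
    (τ : ℕ → Ω → Time T) : Prop :=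
  ∀ k, ∀ᵐ ω ∂P, Φ.value S (τ (k + 1) ω) ω - Φ.value S (τ k ω) ω =
    Φ.stock (τ (k + 1) ω) ω * (S (τ (k + 1) ω) ω - S (τ k ω) ω)

/-- The self-financing simple portfolios, with finitely many stopping times `τ_0 ≤ ⋯ ≤ τ_n ≤ T`.
The finite list is continued by `τ_k = T` for `k > n`, so that the self-financing condition for
`k = n` says that no value is lost or created when the positions are closed at `τ_n < T`. -/
def simple (P : Measure Ω) (𝓕 : Filtration (Time T) m) (hT : 0 ≤ T) (S : Time T → Ω → ℝ) :
    Set (Portfolio 𝓕) :=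
  {Φ | ∃ (n : ℕ) (τ : ℕ → Ω → Time T), (∀ k, n < k → ∀ ω, τ k ω = maturity hT) ∧
    Φ.IsStepAlong P τ (fun _ => n) ∧ Φ.IsSelfFinancingAlong P S τ}

/-- The self-financing almost simple portfolios: a sequence of stopping times that almost surely
reaches `T`, and an `ℕ`-valued random number `N` of summands. -/
def almostSimple (P : Measure Ω) (𝓕 : Filtration (Time T) m) (hT : 0 ≤ T)
    (S : Time T → Ω → ℝ) : Set (Portfolio 𝓕) :=
  {Φ | ∃ (τ : ℕ → Ω → Time T) (N : Ω → ℕ), (∀ᵐ ω ∂P, ∃ k, τ k ω = maturity hT) ∧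
    Measurable N ∧ Φ.IsStepAlong P τ N ∧ Φ.IsSelfFinancingAlong P S τ}

/-! ### Arbitrage -/

/-- Arbitrage. -/
def Portfolio.IsArbitrage (Φ : Portfolio 𝓕) (P : Measure Ω) (hT : 0 ≤ T)
    (S : Time T → Ω → ℝ) : Prop :=
  (∀ᵐ ω ∂P, Φ.value S (initialTime hT) ω = 0) ∧
  (∀ᵐ ω ∂P, 0 ≤ Φ.value S (maturity hT) ω) ∧
  0 < P {ω | 0 < Φ.value S (maturity hT) ω}

/-- Strong arbitrage. -/
def Portfolio.IsStrongArbitrage (Φ : Portfolio 𝓕) (P : Measure Ω) (hT : 0 ≤ T)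
    (S : Time T → Ω → ℝ) : Prop :=
  (∀ᵐ ω ∂P, Φ.value S (initialTime hT) ω = 0) ∧
  ∃ a : ℝ, 0 < a ∧ ∀ᵐ ω ∂P, a ≤ Φ.value S (maturity hT) ω

/-- The sequence `Φ` is approximate arbitrage, with limiting terminal value `V`. -/
def IsApproximateArbitrageWithLimit (Φ : ℕ → Portfolio 𝓕) (P : Measure Ω) (hT : 0 ≤ T)
    (S : Time T → Ω → ℝ) (V : Ω → ℝ) : Prop :=
  (∀ n, ∀ᵐ ω ∂P, (Φ n).value S (initialTime hT) ω = 0) ∧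
  Measurable V ∧
  TendstoInMeasure P (fun n => (Φ n).value S (maturity hT)) atTop V ∧
  (∀ᵐ ω ∂P, 0 ≤ V ω) ∧ 0 < P {ω | 0 < V ω}

/-- Strong approximate arbitrage. -/
def IsStrongApproximateArbitrage (Φ : ℕ → Portfolio 𝓕) (P : Measure Ω) (hT : 0 ≤ T)
    (S : Time T → Ω → ℝ) : Prop :=
  ∃ V : Ω → ℝ, IsApproximateArbitrageWithLimit Φ P hT S V ∧
    ∃ a : ℝ, 0 < a ∧ ∀ᵐ ω ∂P, a ≤ V ω

/-! ### Doubling along `t_k = T (1 - 2^{-k})` -/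

/-- The time `t_k = T (1 - 2^{-k})`. -/
noncomputable def doublingTime (hT : 0 ≤ T) (k : ℕ) : Time T :=
  ⟨T * (1 - (1 / 2) ^ k), by
    have h1 : (1 / 2 : ℝ) ^ k ≤ 1 := pow_le_one₀ (by norm_num) (by norm_num)
    have h0 : (0 : ℝ) ≤ (1 / 2) ^ k := by positivity
    exact ⟨mul_nonneg hT (by linarith), mul_le_of_le_one_right hT (by linarith)⟩⟩

/-- `τ = inf {t_k ; k ≥ 1, (S_{t_k} - S_{t_{k-1}}) / S_{t_{k-1}} ≥ c_k}`, and `T` if there is no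
such `k`. -/
noncomputable def doublingStop (hT : 0 ≤ T) (S : Time T → Ω → ℝ) (c : ℕ → ℝ) (ω : Ω) : ℝ :=
  sInf (insert T {x : ℝ | ∃ k : ℕ, x = doublingTime hT (k + 1) ∧
    c (k + 1) ≤ (S (doublingTime hT (k + 1)) ω - S (doublingTime hT k) ω) /
      S (doublingTime hT k) ω})

/-- The summand `φ_{t_k} 1_{(t_k ∧ τ, t_{k+1} ∧ τ]}(t)` with
`φ_{t_k} = (1 - V_{t_k}(Φ)) / (S_{t_k} c_{k+1})`. -/
noncomputable def doublingTerm (hT : 0 ≤ T) (S : Time T → Ω → ℝ) (c : ℕ → ℝ)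
    (Φ : Portfolio 𝓕) (k : ℕ) (t : Time T) (ω : Ω) : ℝ :=
  (Set.Ioc (min (doublingTime hT k : ℝ) (doublingStop hT S c ω))
      (min (doublingTime hT (k + 1) : ℝ) (doublingStop hT S c ω))).indicator
    (fun _ => (1 - Φ.value S (doublingTime hT k) ω) / (S (doublingTime hT k) ω * c (k + 1)))
    (t : ℝ)

/-- `Φ` is the doubling strategy with thresholds `c`: its stock position is the sum of all
doubling terms (at each time at most one of them is nonzero). -/
def Portfolio.IsDoubling (Φ : Portfolio 𝓕) (P : Measure Ω) (hT : 0 ≤ T)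
    (S : Time T → Ω → ℝ) (c : ℕ → ℝ) : Prop :=
  ∀ᵐ ω ∂P, ∀ t, Φ.stock t ω = ∑' k, doublingTerm hT S c Φ k t ω

/-- `Ψ` is the doubling strategy `Φ` truncated after the summand with index `n`. -/
def Portfolio.IsTruncatedDoubling (Ψ Φ : Portfolio 𝓕) (P : Measure Ω) (hT : 0 ≤ T)
    (S : Time T → Ω → ℝ) (c : ℕ → ℝ) (n : ℕ) : Prop :=
  ∀ᵐ ω ∂P, ∀ t, Ψ.stock t ω = ∑ k ∈ Finset.range (n + 1), doublingTerm hT S c Φ k t ω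

end BlackScholes

namespace BlackScholes

variable {Ω : Type*} {m : MeasurableSpace Ω} {T : ℝ}

theorem initialTime_le (hT : 0 ≤ T) (t : Time T) : initialTime hT ≤ t := t.2.1

theorem le_maturity (hT : 0 ≤ T) (t : Time T) : t ≤ maturity hT := t.2.2

/-! ### Brownian increments -/

namespace IsBrownianMotion

variable {P : Measure Ω} {hT : 0 ≤ T} {W : Time T → Ω → ℝ}

theorem memLp_two (hW : IsBrownianMotion P hT W) (t : Time T) : MemLp (W t) 2 P :=
  (hW.gaussian.hasGaussianLaw_eval t).memLp_two

theorem covariance_increment (hW : IsBrownianMotion P hT W) {r s t : Time T} (hrs : r ≤ s)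
    (hst : s ≤ t) : cov[W r, fun ω => W t ω - W s ω; P] = 0 := by
  have := hW.gaussian.isProbabilityMeasure
  have h1 : (r : ℝ) ≤ s := hrs
  have h2 : (s : ℝ) ≤ t := hst
  rw [covariance_fun_sub_right (hW.memLp_two r) (hW.memLp_two t) (hW.memLp_two s),
    hW.covariance, hW.covariance, min_eq_left h1, min_eq_left (h1.trans h2), sub_self]

/-- An increment after time `s` is independent of the path up to time `s`. -/
theorem indepFun_past_increment (hW : IsBrownianMotion P hT W) {s t : Time T} (hst : s ≤ t) :
    IndepFun (fun ω (r : Set.Iic s) => W r ω) (fun ω => W t ω - W s ω) P := by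
  classical
  have h : IndepFun (fun ω (r : Set.Iic s) => W r ω)
      (fun ω (_ : Unit) => W t ω - W s ω) P := by
    refine IsGaussianProcess.indepFun_of_covariance_eq_zero
      (X := fun (r : Set.Iic s) => W r) (Y := fun (_ : Unit) ω => W t ω - W s ω) ?_
      (fun r => (hW.measurable r).aemeasurable)
      (fun _ => ((hW.measurable t).sub (hW.measurable s)).aemeasurable)
      (fun r _ => hW.covariance_increment r.2 hst)
    refine hW.gaussian.of_isGaussianProcess ?_
    rintro (r | _)
    · exact ⟨{(r : Time T)},
        { toFun x := x ⟨r, by simp⟩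
          map_add' := by simp
          map_smul' := by simp }, by simp⟩
    · exact ⟨{s, t},
        { toFun x := x ⟨t, by simp⟩ - x ⟨s, by simp⟩
          map_add' x y := by simp; abel
          map_smul' c x := by simp; ring }, by simp⟩
  exact h.comp measurable_id (measurable_pi_apply ())

theorem map_increment (hW : IsBrownianMotion P hT W) {s t : Time T} (hst : s ≤ t) :
    P.map (fun ω => W t ω - W s ω) = gaussianReal 0 (t - s : ℝ).toNNReal := by
  have := hW.gaussian.isProbabilityMeasure
  have hs : (s : ℝ) ≤ t := hst
  have hint : ∫ ω, (W t ω - W s ω) ∂P = 0 := by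
    rw [integral_sub ((hW.memLp_two t).integrable (by norm_num))
      ((hW.memLp_two s).integrable (by norm_num)), hW.centered, hW.centered, sub_self]
  have hvar : Var[fun ω => W t ω - W s ω; P] = t - s := by
    rw [variance_fun_sub (hW.memLp_two t) (hW.memLp_two s), ← covariance_self, ← covariance_self,
      hW.covariance, hW.covariance, hW.covariance, min_eq_right hs]
    · simp only [min_self]; ring
    · exact (hW.measurable s).aemeasurable
    · exact (hW.measurable t).aemeasurable
  have h : HasGaussianLaw (fun ω => W t ω - W s ω) P := hW.gaussian.hasGaussianLaw_fun_sub
  rw [h.map_eq_gaussianReal, hint, hvar]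

theorem hasIndepIncrements (hW : IsBrownianMotion P hT W) : HasIndepIncrements W P := by
  have := hW.gaussian.isProbabilityMeasure
  refine fun n t ht ↦ hW.gaussian.hasGaussianLaw_increments.iIndepFun_of_covariance_eq_zero
    fun i j hij ↦ ?_
  wlog h : i < j generalizing i j
  · rw [covariance_comm]
    exact this j i hij.symm (by grind)
  have hmono : ∀ a b : Fin (n + 1), a ≤ b → t a ≤ t b := fun a b hab => ht hab
  rw [covariance_fun_sub_left (hW.memLp_two _) (hW.memLp_two _)
      (show MemLp (fun ω => W (t j.succ) ω - W (t j.castSucc) ω) 2 P from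
        (hW.memLp_two _).sub (hW.memLp_two _)),
    hW.covariance_increment (hmono _ _ ?_) (hmono _ _ ?_),
    hW.covariance_increment (hmono _ _ ?_) (hmono _ _ ?_), sub_self]
  all_goals first | exact Fin.castSucc_le_succ j | skip
  · exact Fin.castSucc_le_castSucc_iff.mpr h.le
  · exact Fin.le_castSucc_iff.mpr (Fin.strictMono_succ h)

theorem integrable_exp_mul_increment (hW : IsBrownianMotion P hT W) {s t : Time T} (hst : s ≤ t)
    (a : ℝ) : Integrable (fun ω => Real.exp (a * (W t ω - W s ω))) P := by
  have h := integrable_exp_mul_gaussianReal (μ := 0) (v := (t - s : ℝ).toNNReal) a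
  rw [← hW.map_increment hst] at h
  exact h.comp_measurable ((hW.measurable t).sub (hW.measurable s))

theorem integral_exp_mul_increment (hW : IsBrownianMotion P hT W) {s t : Time T} (hst : s ≤ t)
    (a : ℝ) : ∫ ω, Real.exp (a * (W t ω - W s ω)) ∂P = Real.exp (a ^ 2 * (t - s) / 2) := by
  have h := mgf_gaussianReal (hW.map_increment hst) a
  rw [mgf] at h
  rw [h, Real.coe_toNNReal _ (sub_nonneg.2 (show (s : ℝ) ≤ t from hst))]
  congr 1
  ring

theorem integrable_exp_mul (hW : IsBrownianMotion P hT W) (t : Time T) (a : ℝ) :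
    Integrable (fun ω => Real.exp (a * W t ω)) P := by
  refine (hW.integrable_exp_mul_increment (initialTime_le hT t) a).congr ?_
  filter_upwards [hW.zero] with ω hω
  rw [hω, sub_zero]

theorem integrable_exp_add (hW : IsBrownianMotion P hT W) {s t : Time T} (hst : s ≤ t)
    (a b : ℝ) : Integrable (fun ω => Real.exp (a * W t ω + b * W s ω)) P := by
  have h : IndepFun (fun ω => Real.exp ((a + b) * W s ω))
      (fun ω => Real.exp (a * (W t ω - W s ω))) P :=
    (hW.indepFun_past_increment hst).comp
      (φ := fun x : Set.Iic s → ℝ => Real.exp ((a + b) * x ⟨s, Set.mem_Iic.2 le_rfl⟩))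
      (ψ := fun x => Real.exp (a * x)) (by fun_prop) (by fun_prop)
  refine (h.integrable_mul (hW.integrable_exp_mul s _)
    (hW.integrable_exp_mul_increment hst _)).congr (ae_of_all _ fun ω => ?_)
  simp only [Pi.mul_apply, ← Real.exp_add]
  congr 1
  ring

/-- Integrating out the increment of the Brownian motion after time `s`. -/
theorem setIntegral_exp_add (hW : IsBrownianMotion P hT W) {s t : Time T} (hst : s ≤ t)
    (a b : ℝ) {A : Set Ω}
    (hA : MeasurableSet[MeasurableSpace.comap (fun ω (r : Set.Iic s) => W r ω) inferInstance] A) :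
    ∫ ω in A, Real.exp (a * W t ω + b * W s ω) ∂P =
      Real.exp (a ^ 2 * (t - s) / 2) * ∫ ω in A, Real.exp ((a + b) * W s ω) ∂P := by
  obtain ⟨B, hB, rfl⟩ := hA
  have hX : Measurable (fun ω (r : Set.Iic s) => W r ω) :=
    measurable_pi_lambda _ fun r => hW.measurable r
  have hm := hX hB
  have hf : Measurable (B.indicator fun x : Set.Iic s → ℝ =>
      Real.exp ((a + b) * x ⟨s, Set.mem_Iic.2 le_rfl⟩)) :=
    Measurable.indicator (by fun_prop) hB
  have h := (hW.indepFun_past_increment hst).integral_fun_comp_mul_comp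
    (f := B.indicator fun x => Real.exp ((a + b) * x ⟨s, Set.mem_Iic.2 le_rfl⟩))
    (g := fun x => Real.exp (a * x)) hX.aemeasurable
    ((hW.measurable t).sub (hW.measurable s)).aemeasurable hf.aestronglyMeasurable
    (Measurable.aestronglyMeasurable (by fun_prop))
  rw [hW.integral_exp_mul_increment hst] at h
  rw [← integral_indicator hm, ← integral_indicator hm, mul_comm]
  refine Eq.trans (integral_congr_ae (ae_of_all _ fun ω => ?_)) h
  by_cases hω : (fun r : Set.Iic s => W r ω) ∈ B
  · simp only [Set.indicator, Set.mem_preimage, hω, if_true, ← Real.exp_add]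
    congr 1
    ring
  · simp [Set.indicator, hω]

end IsBrownianMotion

/-! ### The deflator -/

/-- An unnormalised density of the martingale measure. -/
noncomputable def deflator (hT : 0 ≤ T) (μ σ : ℝ) (W : Time T → Ω → ℝ) (ω : Ω) : ℝ :=
  Real.exp (-(μ / σ) * W (maturity hT) ω)

theorem deflator_pos {μ σ : ℝ} {W : Time T → Ω → ℝ} (hT : 0 ≤ T) (ω : Ω) :
    0 < deflator hT μ σ W ω := Real.exp_pos _

theorem measurable_deflator {μ σ : ℝ} {W : Time T → Ω → ℝ} (hT : 0 ≤ T)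
    (hW : ∀ t, Measurable (W t)) :
    Measurable (deflator hT μ σ W) := by
  have := hW (maturity hT)
  unfold deflator
  fun_prop

theorem deflator_mul_price {s₀ μ σ : ℝ} {W : Time T → Ω → ℝ} (hT : 0 ≤ T) (t : Time T) (ω : Ω) :
    deflator hT μ σ W ω * price s₀ μ σ W t ω = s₀ * Real.exp (μ * t - σ ^ 2 * t / 2) *
      Real.exp (-(μ / σ) * W (maturity hT) ω + σ * W t ω) := by
  rw [deflator, price, mul_left_comm, mul_assoc, ← Real.exp_add, ← Real.exp_add]
  congr 2
  ring

theorem integrable_deflator_mul_price {P : Measure Ω} {s₀ μ σ : ℝ} {W : Time T → Ω → ℝ}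
    {hT : 0 ≤ T} (hB : IsBrownianMotion P hT W) (t : Time T) :
    Integrable (fun ω => deflator hT μ σ W ω * price s₀ μ σ W t ω) P := by
  simp_rw [deflator_mul_price]
  exact (hB.integrable_exp_add (le_maturity hT t) _ _).const_mul _

theorem deflator_mul_price_sq {s₀ μ σ : ℝ} {W : Time T → Ω → ℝ} (hT : 0 ≤ T) (t : Time T)
    (ω : Ω) : (deflator hT μ σ W ω * price s₀ μ σ W t ω) ^ 2 =
      (s₀ ^ 2 * Real.exp (2 * (μ * t - σ ^ 2 * t / 2))) *
        Real.exp (-2 * (μ / σ) * W (maturity hT) ω + 2 * σ * W t ω) := by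
  rw [deflator_mul_price, mul_pow, mul_pow, ← Real.exp_nat_mul, ← Real.exp_nat_mul]
  push_cast
  congr 2
  ring

theorem integrable_deflator_mul_price_sq {P : Measure Ω} {s₀ μ σ : ℝ} {W : Time T → Ω → ℝ}
    {hT : 0 ≤ T} (hB : IsBrownianMotion P hT W) (t : Time T) :
    Integrable (fun ω => (deflator hT μ σ W ω * price s₀ μ σ W t ω) ^ 2) P := by
  simp_rw [deflator_mul_price_sq]
  exact (hB.integrable_exp_add (le_maturity hT t) _ _).const_mul _

/-! ### The augmented filtration -/

/-- The filtration generated by the price and the null sets. -/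
noncomputable def nullAugmentation (P : Measure Ω) [P.IsComplete] (s₀ μ σ : ℝ)
    (W : Time T → Ω → ℝ) (hW : ∀ t, Measurable (W t)) : Filtration (Time T) m :=
  Filtration.natural (price s₀ μ σ W) (fun t => (measurable_price s₀ μ σ hW t).stronglyMeasurable) ⊔
    Filtration.const (Time T) (MeasurableSpace.generateFrom {s : Set Ω | P s = 0})
    (MeasurableSpace.generateFrom_le fun s hs => Measure.IsComplete.out' s hs)

section Augmentation

variable {P : Measure Ω} [P.IsComplete] {s₀ μ σ : ℝ} {W : Time T → Ω → ℝ}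
  {hW : ∀ t, Measurable (W t)}

theorem priceFiltration_eq :
    priceFiltration P s₀ μ σ W hW = (nullAugmentation P s₀ μ σ W hW).rightCont := rfl

theorem nullAugmentation_le_priceFiltration (t : Time T) :
    nullAugmentation P s₀ μ σ W hW t ≤ priceFiltration P s₀ μ σ W hW t :=
  Filtration.le_rightCont _ t

theorem priceFiltration_le_nullAugmentation {s t : Time T} (hst : s < t) :
    priceFiltration P s₀ μ σ W hW s ≤ nullAugmentation P s₀ μ σ W hW t := by
  rw [priceFiltration_eq, Filtration.rightCont_eq_of_not_isMax _ (not_isMax_iff.2 ⟨t, hst⟩)]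
  exact iInf₂_le t hst

theorem priceFiltration_maturity (hT : 0 ≤ T) :
    priceFiltration P s₀ μ σ W hW (maturity hT) = nullAugmentation P s₀ μ σ W hW (maturity hT) := by
  rw [priceFiltration_eq, Filtration.rightCont_eq_of_isMax _ fun t _ => le_maturity hT t]

theorem adapted_price : Adapted (priceFiltration P s₀ μ σ W hW) (price s₀ μ σ W) := fun t =>
  ((Filtration.stronglyAdapted_natural (fun t =>
    (measurable_price s₀ μ σ hW t).stronglyMeasurable) t).measurable.mono
      le_sup_left le_rfl).mono (nullAugmentation_le_priceFiltration t) le_rfl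

theorem measurableSet_priceFiltration_of_null {s : Set Ω} (hs : P s = 0) (t : Time T) :
    MeasurableSet[priceFiltration P s₀ μ σ W hW t] s :=
  nullAugmentation_le_priceFiltration t s
    ((le_sup_right : _ ≤ nullAugmentation P s₀ μ σ W hW t) s
      (MeasurableSpace.measurableSet_generateFrom hs))

/-- Up to null sets, an event of the null-augmented filtration depends on the past of `W` only. -/
theorem exists_ae_eq_of_measurableSet_nullAugmentation {t : Time T} {A : Set Ω}
    (hA : MeasurableSet[nullAugmentation P s₀ μ σ W hW t] A) :
    ∃ B, MeasurableSet[MeasurableSpace.comap (fun ω (r : Set.Iic t) => W r ω) inferInstance] B ∧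
      A =ᵐ[P] B := by
  have h : nullAugmentation P s₀ μ σ W hW t ≤ eventuallyMeasurableSpace
      (MeasurableSpace.comap (fun ω (r : Set.Iic t) => W r ω) inferInstance) (ae P) := by
    refine sup_le ?_ (MeasurableSpace.generateFrom_le fun s hs => ?_)
    · refine le_trans ?_ le_eventuallyMeasurableSpace
      refine iSup₂_le fun r hr => ?_
      have h1 : Measurable fun x : Set.Iic t → ℝ =>
          s₀ * Real.exp (μ * r + σ * x ⟨r, hr⟩ - σ ^ 2 * r / 2) := by fun_prop
      exact (h1.comp (comap_measurable fun ω (r : Set.Iic t) => W r ω)).comap_le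
    · exact ⟨∅, @MeasurableSet.empty _ (_), ae_eq_empty.2 hs⟩
  exact h A hA

theorem IsBrownianMotion.setIntegral_exp_add_of_nullAugmentation {hT : 0 ≤ T}
    (hB : IsBrownianMotion P hT W) {s t : Time T} (hst : s ≤ t)
    (a b : ℝ) {A : Set Ω} (hA : MeasurableSet[nullAugmentation P s₀ μ σ W hW s] A) :
    ∫ ω in A, Real.exp (a * W t ω + b * W s ω) ∂P =
      Real.exp (a ^ 2 * (t - s) / 2) * ∫ ω in A, Real.exp ((a + b) * W s ω) ∂P := by
  obtain ⟨B, hBm, hAB⟩ := exists_ae_eq_of_measurableSet_nullAugmentation hA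
  rw [setIntegral_congr_set hAB, setIntegral_congr_set hAB, hB.setIntegral_exp_add hst a b hBm]

theorem IsBrownianMotion.setIntegral_exp_of_nullAugmentation {hT : 0 ≤ T}
    (hB : IsBrownianMotion P hT W) {s t : Time T} (hst : s ≤ t)
    (a : ℝ) {A : Set Ω} (hA : MeasurableSet[nullAugmentation P s₀ μ σ W hW s] A) :
    ∫ ω in A, Real.exp (a * W t ω) ∂P =
      Real.exp (a ^ 2 * (t - s) / 2) * ∫ ω in A, Real.exp (a * W s ω) ∂P := by
  simpa using hB.setIntegral_exp_add_of_nullAugmentation hst a 0 hA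

/-- The deflated price is a martingale. -/
theorem setIntegral_deflator_mul_price {hT : 0 ≤ T} (hB : IsBrownianMotion P hT W) (hσ : σ ≠ 0)
    {t : Time T} {A : Set Ω} (hA : MeasurableSet[nullAugmentation P s₀ μ σ W hW t] A) :
    ∫ ω in A, deflator hT μ σ W ω * price s₀ μ σ W t ω ∂P =
      ∫ ω in A, deflator hT μ σ W ω * price s₀ μ σ W (maturity hT) ω ∂P := by
  simp_rw [deflator_mul_price, ← add_mul]
  rw [integral_const_mul, integral_const_mul,
    hB.setIntegral_exp_add_of_nullAugmentation (le_maturity hT t) _ _ hA,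
    hB.setIntegral_exp_of_nullAugmentation (le_maturity hT t) _ hA]
  have key : Real.exp (μ * t - σ ^ 2 * t / 2) *
      Real.exp ((-(μ / σ)) ^ 2 * ((maturity hT : ℝ) - t) / 2) =
      Real.exp (μ * (maturity hT : ℝ) - σ ^ 2 * (maturity hT : ℝ) / 2) *
        Real.exp ((-(μ / σ) + σ) ^ 2 * ((maturity hT : ℝ) - t) / 2) := by
    rw [← Real.exp_add, ← Real.exp_add]
    congr 1
    field_simp
    ring
  linear_combination s₀ * (∫ ω in A, Real.exp ((-(μ / σ) + σ) * W t ω) ∂P) * key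

/-- The square of the deflated price is controlled by an integrable function at maturity. -/
theorem setIntegral_deflator_mul_price_sq_le {hT : 0 ≤ T} (hB : IsBrownianMotion P hT W)
    {t : Time T} {A : Set Ω} (hA : MeasurableSet[nullAugmentation P s₀ μ σ W hW t] A) :
    ∫ ω in A, (deflator hT μ σ W ω * price s₀ μ σ W t ω) ^ 2 ∂P ≤
      s₀ ^ 2 * Real.exp (2 * |μ| * T + 2 * (μ / σ) ^ 2 * T) *
        ∫ ω in A, Real.exp (2 * (σ - μ / σ) * W (maturity hT) ω) ∂P := by
  simp_rw [deflator_mul_price_sq]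
  rw [integral_const_mul, hB.setIntegral_exp_add_of_nullAugmentation (le_maturity hT t) _ _ hA,
    hB.setIntegral_exp_of_nullAugmentation (le_maturity hT t) _ hA,
    show -2 * (μ / σ) + 2 * σ = 2 * (σ - μ / σ) by ring, ← mul_assoc, ← mul_assoc]
  refine mul_le_mul_of_nonneg_right ?_ (integral_nonneg fun ω => (Real.exp_pos _).le)
  rw [mul_assoc (s₀ ^ 2), mul_assoc (s₀ ^ 2), ← Real.exp_add, ← Real.exp_add]
  refine mul_le_mul_of_nonneg_left (Real.exp_le_exp.2 ?_) (sq_nonneg _)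
  have ht0 : (0 : ℝ) ≤ t := t.2.1
  have htT : (t : ℝ) ≤ T := t.2.2
  have h2 : μ * t ≤ |μ| * T := (mul_le_mul_of_nonneg_right (le_abs_self μ) ht0).trans
    (mul_le_mul_of_nonneg_left htT (abs_nonneg _))
  have h3 : 0 ≤ σ ^ 2 * t := by positivity
  have h4 : 0 ≤ (μ / σ) ^ 2 * t := by positivity
  have h5 : 0 ≤ (σ - μ / σ) ^ 2 * (T - t) := mul_nonneg (sq_nonneg _) (sub_nonneg.2 htT)
  change _ + (-2 * (μ / σ)) ^ 2 * (T - t) / 2 ≤ _ + (2 * (σ - μ / σ)) ^ 2 * (T - t) / 2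
  nlinarith

end Augmentation

/-! ### Convergence of integrals under an `L²` bound -/

theorem uniformIntegrable_of_eLpNorm_two_le {P : Measure Ω} [IsProbabilityMeasure P]
    {f : ℕ → Ω → ℝ} (hf : ∀ n, AEStronglyMeasurable (f n) P) {C : NNReal}
    (hC : ∀ n, eLpNorm (f n) 2 P ≤ C) : UniformIntegrable f 1 P := by
  refine ⟨hf, fun ε hε => ?_, C, fun n => ?_⟩
  · have hδ : 0 < (ε / (C + 1)) ^ 2 := by positivity
    refine ⟨_, hδ, fun n s hs hsδ => ?_⟩
    rw [eLpNorm_indicator_eq_eLpNorm_restrict hs]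
    have h1 := eLpNorm_le_eLpNorm_mul_rpow_measure_univ (μ := P.restrict s) (p := 1) (q := 2)
      (by norm_num) (hf n).restrict
    refine h1.trans ?_
    have h2 : eLpNorm (f n) 2 (P.restrict s) ≤ C :=
      (eLpNorm_mono_measure _ Measure.restrict_le_self).trans (hC n)
    have h3 : P.restrict s univ ^ (1 / (1 : ENNReal).toReal - 1 / (2 : ENNReal).toReal) ≤
        ENNReal.ofReal (ε / (C + 1)) := by
      rw [Measure.restrict_apply_univ]
      have : (1 / (1 : ENNReal).toReal - 1 / (2 : ENNReal).toReal) = (1 / 2 : ℝ) := by norm_num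
      rw [this]
      refine (ENNReal.rpow_le_rpow hsδ (by norm_num)).trans ?_
      rw [ENNReal.ofReal_rpow_of_nonneg hδ.le (by norm_num), ← Real.sqrt_eq_rpow,
        Real.sqrt_sq (by positivity)]
    refine (mul_le_mul' h2 h3).trans ?_
    rw [← ENNReal.ofReal_coe_nnreal, ← ENNReal.ofReal_mul NNReal.zero_le_coe]
    refine ENNReal.ofReal_le_ofReal ?_
    have : (C : ℝ) * (ε / (C + 1)) = ε * (C / (C + 1)) := by ring
    rw [this]
    exact mul_le_of_le_one_right hε.le ((div_le_one (by positivity)).2 (by linarith))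
  · exact (eLpNorm_le_eLpNorm_of_exponent_le (by norm_num) (hf n)).trans (hC n)

theorem tendsto_setIntegral_of_sq_bound {P : Measure Ω} [IsProbabilityMeasure P]
    {f : ℕ → Ω → ℝ} {g : Ω → ℝ} (hf : ∀ n, AEStronglyMeasurable (f n) P) {C : ℝ}
    (hfi : ∀ n, Integrable (fun ω => f n ω ^ 2) P) (hC : ∀ n, ∫ ω, f n ω ^ 2 ∂P ≤ C)
    (hfg : ∀ᵐ ω ∂P, Tendsto (fun n => f n ω) atTop (𝓝 (g ω))) :
    Integrable g P ∧ ∀ A, Tendsto (fun n => ∫ ω in A, f n ω ∂P) atTop (𝓝 (∫ ω in A, g ω ∂P)) := by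
  have hC' : ∀ n, eLpNorm (f n) 2 P ≤ (Real.sqrt C).toNNReal := by
    intro n
    have h2 : MemLp (f n) 2 P := (memLp_two_iff_integrable_sq (hf n)).2 (hfi n)
    rw [h2.eLpNorm_eq_integral_rpow_norm (by norm_num) (by norm_num)]
    refine ENNReal.ofReal_le_ofReal ?_
    simp only [ENNReal.toReal_ofNat, Real.rpow_two, Real.norm_eq_abs, sq_abs]
    rw [← one_div, ← Real.sqrt_eq_rpow]
    exact Real.sqrt_le_sqrt (hC n)
  have hui := uniformIntegrable_of_eLpNorm_two_le hf hC'
  have hg : Integrable g P := hui.integrable_of_ae_tendsto hfg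
  refine ⟨hg, fun A => ?_⟩
  have hL := tendsto_Lp_finite_of_tendsto_ae (p := 1) le_rfl (by norm_num) hf
    (memLp_one_iff_integrable.2 hg) hui.unifIntegrable hfg
  exact tendsto_setIntegral_of_L1' g hg.1
    (Eventually.of_forall fun n => (hui.memLp n).integrable le_rfl) hL A

/-! ### Optional stopping -/

/-- The grid point `T j / (n + 1)`, cut off at `T`. -/
noncomputable def gridPoint (hT : 0 ≤ T) (n j : ℕ) : Time T :=
  ⟨min (T * (j / (n + 1))) T, le_min (by positivity) hT, min_le_right _ _⟩

/-- The index of the first grid point strictly after `t`. -/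
noncomputable def gridIndex (n : ℕ) (t : Time T) : ℕ := ⌊(n + 1) * (t : ℝ) / T⌋₊ + 1

theorem gridIndex_le (hT : 0 < T) (n : ℕ) (t : Time T) : gridIndex n t ≤ n + 2 := by
  have h : ⌊(n + 1) * (t : ℝ) / T⌋₊ ≤ n + 1 := by
    refine Nat.floor_le_of_le ?_
    rw [div_le_iff₀ hT]
    push_cast
    exact mul_le_mul_of_nonneg_left t.2.2 (by positivity)
  unfold gridIndex
  omega

theorem gridIndex_eq_succ_iff (hT : 0 < T) {n j : ℕ} (t : Time T) :
    gridIndex n t = j + 1 ↔ T * (j / (n + 1)) ≤ t ∧ (t : ℝ) < T * ((j + 1) / (n + 1)) := by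
  have h0 : 0 ≤ (n + 1) * (t : ℝ) / T := div_nonneg (mul_nonneg (by positivity) t.2.1) hT.le
  rw [gridIndex, Nat.add_right_cancel_iff, Nat.floor_eq_iff h0, le_div_iff₀ hT, div_lt_iff₀ hT,
    mul_div_assoc', mul_div_assoc', div_le_iff₀ (by positivity), lt_div_iff₀ (by positivity),
    mul_comm T, mul_comm T, mul_comm (t : ℝ)]

theorem tendsto_gridPoint_gridIndex (hT : 0 < T) (t : Time T) :
    Tendsto (fun n => gridPoint hT.le n (gridIndex n t)) atTop (𝓝 t) := by
  rw [tendsto_subtype_rng]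
  have h1 : ∀ n : ℕ, (t : ℝ) ≤ gridPoint hT.le n (gridIndex n t) ∧
      (gridPoint hT.le n (gridIndex n t) : ℝ) ≤ t + T * (1 / ((n : ℝ) + 1)) := by
    intro n
    have h := (gridIndex_eq_succ_iff hT (n := n) (j := ⌊(n + 1) * (t : ℝ) / T⌋₊) t).1 rfl
    constructor
    · refine le_min ?_ t.2.2
      rw [gridIndex]
      push_cast
      exact h.2.le
    · refine (min_le_left _ _).trans ?_
      rw [gridIndex]
      push_cast
      rw [add_div, mul_add]
      linarith [h.1]
  refine tendsto_of_tendsto_of_tendsto_of_le_of_le tendsto_const_nhds ?_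
    (fun n => (h1 n).1) (fun n => (h1 n).2)
  simpa using (tendsto_one_div_add_atTop_nhds_zero_nat (𝕜 := ℝ)).const_mul T |>.const_add (t : ℝ)

theorem gridPoint_last (hT : 0 < T) (n : ℕ) :
    gridPoint hT.le n (n + 1 + 1) = maturity hT.le := by
  refine Subtype.ext (min_eq_right (le_mul_of_one_le_right hT.le ?_))
  rw [le_div_iff₀ (by positivity)]
  push_cast
  linarith

section Stopping

variable {P : Measure Ω} [P.IsComplete] {s₀ μ σ : ℝ} {W : Time T → Ω → ℝ}
  {hW : ∀ t, Measurable (W t)} {ρ : Ω → Time T}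

theorem measurableSet_inter_lt (hρ : IsStoppingTime (priceFiltration P s₀ μ σ W hW)
    (fun ω => (ρ ω : WithTop (Time T)))) {A : Set Ω} (hA : MeasurableSet[hρ.measurableSpace] A)
    (t : Time T) : MeasurableSet[nullAugmentation P s₀ μ σ W hW t] (A ∩ {ω | ρ ω < t}) := by
  obtain ⟨D, hD, hDd⟩ := TopologicalSpace.exists_countable_dense (Time T)
  have h : A ∩ {ω | ρ ω < t} = ⋃ q ∈ D ∩ Set.Iio t, A ∩ {ω | (ρ ω : WithTop (Time T)) ≤ q} := by
    ext ω
    simp only [Set.mem_inter_iff, Set.mem_ofPred_eq, Set.mem_iUnion, WithTop.coe_le_coe,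
      Set.mem_Iio, exists_prop]
    constructor
    · rintro ⟨h1, h2⟩
      obtain ⟨q, hq, hq1, hq2⟩ := hDd.exists_between h2
      exact ⟨q, ⟨hq, hq2⟩, h1, hq1.le⟩
    · rintro ⟨q, ⟨_, hq⟩, h1, h2⟩
      exact ⟨h1, h2.trans_lt hq⟩
  rw [h]
  exact MeasurableSet.biUnion (hD.mono Set.inter_subset_left) fun q hq =>
    priceFiltration_le_nullAugmentation hq.2 _ (hA.2 q)

theorem measurableSet_inter_gridIndex (hT : 0 < T)
    (hρ : IsStoppingTime (priceFiltration P s₀ μ σ W hW)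
    (fun ω => (ρ ω : WithTop (Time T)))) {A : Set Ω} (hA : MeasurableSet[hρ.measurableSpace] A)
    {n j : ℕ} (hj : j ≤ n + 2) : MeasurableSet[nullAugmentation P s₀ μ σ W hW
      (gridPoint hT.le n j)] (A ∩ {ω | gridIndex n (ρ ω) = j}) := by
  rcases j with _ | j
  · have : A ∩ {ω | gridIndex n (ρ ω) = 0} = ∅ := by
      ext ω
      simp [gridIndex]
    rw [this]
    exact @MeasurableSet.empty _ (_)
  have hgrid : ∀ i ≤ n + 1, (gridPoint hT.le n i : ℝ) = T * (i / (n + 1)) := by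
    intro i hi
    refine min_eq_left (mul_le_of_le_one_right hT.le ((div_le_one (by positivity)).2 ?_))
    exact_mod_cast hi
  have hmono : gridPoint hT.le n j ≤ gridPoint hT.le n (j + 1) := by
    refine Subtype.coe_le_coe.1 (min_le_min_right T ?_)
    push_cast
    gcongr
    linarith
  have h : A ∩ {ω | gridIndex n (ρ ω) = j + 1} =
      (A ∩ {ω | (ρ ω : ℝ) < T * ((j + 1) / (n + 1))}) \
        (A ∩ {ω | ρ ω < gridPoint hT.le n j}) := by
    ext ω
    simp only [Set.mem_inter_iff, Set.mem_ofPred_eq, Set.mem_sdiff, gridIndex_eq_succ_iff hT,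
      ← Subtype.coe_lt_coe, hgrid j (by omega)]
    rw [← not_lt (a := (ρ ω : ℝ))]
    tauto
  rw [h]
  refine MeasurableSet.diff ?_
    ((nullAugmentation P s₀ μ σ W hW).mono hmono _ (measurableSet_inter_lt hρ hA _))
  rcases Nat.lt_or_ge j (n + 1) with hjn | hjn
  · have := measurableSet_inter_lt hρ hA (gridPoint hT.le n (j + 1))
    simp only [← Subtype.coe_lt_coe, hgrid (j + 1) hjn] at this
    exact_mod_cast this
  · obtain rfl : j = n + 1 := by omega
    have hg := gridPoint_last hT n
    have hA' : A ∩ {ω | (ρ ω : ℝ) < T * (((n + 1 : ℕ) + 1) / (n + 1))} =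
        A ∩ {ω | (ρ ω : WithTop (Time T)) ≤ maturity hT.le} := by
      ext ω
      simp only [Set.mem_inter_iff, Set.mem_ofPred_eq, WithTop.coe_le_coe, le_maturity, and_true,
        and_iff_left_iff_imp]
      intro _
      refine (ρ ω).2.2.trans_lt (lt_mul_of_one_lt_right hT ?_)
      rw [lt_div_iff₀ (by positivity)]
      push_cast
      linarith
    rw [hA', hg, ← priceFiltration_maturity]
    exact hA.2 _

theorem measurable_of_isStoppingTime (hρ : IsStoppingTime (priceFiltration P s₀ μ σ W hW)
    (fun ω => (ρ ω : WithTop (Time T)))) : Measurable ρ :=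
  measurable_of_Iic fun t => by
    have := (priceFiltration P s₀ μ σ W hW).le t _ (hρ t)
    simp only [WithTop.coe_le_coe] at this
    exact this

variable [IsProbabilityMeasure P]

/-- Optional stopping for the deflated price. -/
theorem setIntegral_deflator_mul_price_stopped (hT : 0 < T) (hB : IsBrownianMotion P hT.le W)
    (hσ : σ ≠ 0) (hρ : IsStoppingTime (priceFiltration P s₀ μ σ W hW)
    (fun ω => (ρ ω : WithTop (Time T)))) :
    Integrable (fun ω => deflator hT.le μ σ W ω * price s₀ μ σ W (ρ ω) ω) P ∧
    ∀ A, MeasurableSet[hρ.measurableSpace] A →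
      ∫ ω in A, deflator hT.le μ σ W ω * price s₀ μ σ W (ρ ω) ω ∂P =
        ∫ ω in A, deflator hT.le μ σ W ω * price s₀ μ σ W (maturity hT.le) ω ∂P := by
  set F : Time T → Ω → ℝ := fun t ω => deflator hT.le μ σ W ω * price s₀ μ σ W t ω with hF
  have hFm : ∀ t, Measurable (F t) := fun t =>
    (measurable_deflator hT.le hW).mul (measurable_price s₀ μ σ hW t)
  have hFi : ∀ t, Integrable (F t) P := fun t => integrable_deflator_mul_price hB t
  have hρm := measurable_of_isStoppingTime hρ
  have hIm : ∀ n j, MeasurableSet {ω | gridIndex n (ρ ω) = j} := by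
    intro n j
    have : Measurable fun ω => gridIndex n (ρ ω) := by
      unfold gridIndex
      have : Measurable fun ω => (ρ ω : ℝ) := hρm.subtype_val
      fun_prop
    exact this (measurableSet_singleton j)
  set f : ℕ → Ω → ℝ := fun n ω => F (gridPoint hT.le n (gridIndex n (ρ ω))) ω with hf
  have hfsum : ∀ (G : ℝ → ℝ) n ω, G (f n ω) = ∑ j ∈ Finset.range (n + 3),
      Set.indicator {ω | gridIndex n (ρ ω) = j} (fun ω => G (F (gridPoint hT.le n j) ω)) ω := by
    intro G n ω
    rw [Finset.sum_eq_single (gridIndex n (ρ ω))]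
    · simp [hf]
    · intro j _ hj
      rw [Set.indicator_of_notMem]
      exact fun h => hj (Eq.symm h)
    · intro h
      exact absurd (Finset.mem_range.2 (by have := gridIndex_le hT n (ρ ω); omega)) h
  have hfm : ∀ n, Measurable (f n) := by
    intro n
    have : f n = fun ω => ∑ j ∈ Finset.range (n + 3),
      Set.indicator {ω | gridIndex n (ρ ω) = j} (fun ω => F (gridPoint hT.le n j) ω) ω :=
        funext (hfsum id n)
    rw [this]
    exact Finset.measurable_fun_sum _ fun j _ => (hFm _).indicator (hIm n j)
  have hpart : ∀ (G : ℝ → ℝ) (A : Set Ω) (n : ℕ), MeasurableSet A →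
      (∀ t, Integrable (fun ω => G (F t ω)) P) →
      Integrable (fun ω => G (f n ω)) P ∧
      ∫ ω in A, G (f n ω) ∂P = ∑ j ∈ Finset.range (n + 3),
        ∫ ω in A ∩ {ω | gridIndex n (ρ ω) = j}, G (F (gridPoint hT.le n j) ω) ∂P := by
    intro G A n hA hG
    have hi : ∀ j ∈ Finset.range (n + 3), Integrable
        (Set.indicator {ω | gridIndex n (ρ ω) = j} fun ω => G (F (gridPoint hT.le n j) ω)) P :=
      fun j _ => (hG _).indicator (hIm n j)
    simp_rw [hfsum G n]
    refine ⟨integrable_finsetSum _ hi, ?_⟩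
    rw [integral_finsetSum _ fun j hj => (hi j hj).integrableOn]
    refine Finset.sum_congr rfl fun j _ => ?_
    rw [setIntegral_indicator (hIm n j)]
  have hsplit : ∀ (g : Ω → ℝ) (A : Set Ω) (n : ℕ), MeasurableSet A → Integrable g P →
      ∫ ω in A, g ω ∂P = ∑ j ∈ Finset.range (n + 3),
        ∫ ω in A ∩ {ω | gridIndex n (ρ ω) = j}, g ω ∂P := by
    intro g A n hA hg
    have : A = ⋃ j ∈ Finset.range (n + 3), A ∩ {ω | gridIndex n (ρ ω) = j} := by
      ext ω
      simp only [Finset.mem_range, Set.mem_iUnion, Set.mem_inter_iff, Set.mem_ofPred_eq,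
        exists_prop]
      refine ⟨fun h => ⟨_, ?_, h, rfl⟩, fun ⟨_, _, h, _⟩ => h⟩
      have := gridIndex_le hT n (ρ ω)
      omega
    conv_lhs => rw [this]
    rw [integral_biUnion_finset _ (fun j _ => hA.inter (hIm n j)) ?_
      (fun j _ => hg.integrableOn)]
    intro i _ j _ hij
    refine Set.disjoint_left.2 fun ω h1 h2 => hij ?_
    rw [← h1.2, ← h2.2]
  have hsq : ∀ t, Integrable (fun ω => F t ω ^ 2) P := integrable_deflator_mul_price_sq hB
  have hK : Integrable (fun ω => Real.exp (2 * (σ - μ / σ) * W (maturity hT.le) ω)) P :=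
    hB.integrable_exp_mul _ _
  obtain ⟨hint, hlim⟩ := tendsto_setIntegral_of_sq_bound (P := P) (f := f)
    (g := fun ω => F (ρ ω) ω) (fun n => (hfm n).aestronglyMeasurable)
    (fun n => (hpart (fun x => x ^ 2) Set.univ n MeasurableSet.univ hsq).1)
    (C := s₀ ^ 2 * Real.exp (2 * |μ| * T + 2 * (μ / σ) ^ 2 * T) *
        ∫ ω, Real.exp (2 * (σ - μ / σ) * W (maturity hT.le) ω) ∂P)
    (fun n => by
      have h := (hpart (fun x => x ^ 2) Set.univ n MeasurableSet.univ hsq).2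
      rw [setIntegral_univ] at h
      have h' := hsplit _ Set.univ n MeasurableSet.univ hK
      rw [setIntegral_univ] at h'
      rw [h, h', Finset.mul_sum]
      refine Finset.sum_le_sum fun j hj => ?_
      exact setIntegral_deflator_mul_price_sq_le hB (measurableSet_inter_gridIndex hT hρ
        (@MeasurableSet.univ _ (_)) (by have := Finset.mem_range.1 hj; omega)))
    (by
      filter_upwards [hB.continuous] with ω hω
      have hc : Continuous fun t => F t ω := by
        simp only [hF, price]
        fun_prop
      exact (hc.tendsto _).comp (tendsto_gridPoint_gridIndex hT (ρ ω)))
  refine ⟨hint, fun A hA => ?_⟩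
  have hAm := hρ.measurableSpace_le A hA
  refine tendsto_nhds_unique (hlim A) (tendsto_const_nhds.congr fun n => ?_)
  refine Eq.trans ?_ (hpart (fun x => x) A n hAm hFi).2.symm
  rw [hsplit _ A n hAm (hFi (maturity hT.le))]
  refine Finset.sum_congr rfl fun j hj => ?_
  exact (setIntegral_deflator_mul_price hB hσ (measurableSet_inter_gridIndex hT hρ hA
    (by have := Finset.mem_range.1 hj; omega))).symm

end Stopping

/-! ### No arbitrage with simple strategies -/

section NoArbitrage

variable {P : Measure Ω} [P.IsComplete] {s₀ μ σ : ℝ} {W : Time T → Ω → ℝ}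
  {hW : ∀ t, Measurable (W t)}

theorem exists_measurable_ae_eq_stopped_price {hT : 0 ≤ T} (hB : IsBrownianMotion P hT W)
    {ρ : Ω → Time T} (hρ : IsStoppingTime (priceFiltration P s₀ μ σ W hW)
    (fun ω => (ρ ω : WithTop (Time T)))) :
    ∃ X, Measurable[hρ.measurableSpace] X ∧ X =ᵐ[P] fun ω => price s₀ μ σ W (ρ ω) ω := by
  have : Nonempty (Time T) := ⟨initialTime hT⟩
  set C : Set Ω := {ω | Continuous fun t => W t ω}
  have hC : P Cᶜ = 0 := hB.continuous
  have hCm : ∀ t, MeasurableSet[priceFiltration P s₀ μ σ W hW t] C := fun t =>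
    MeasurableSet.of_compl (measurableSet_priceFiltration_of_null hC t)
  set S : Time T → Ω → ℝ := fun t => C.indicator (price s₀ μ σ W t)
  have hS : StronglyAdapted (priceFiltration P s₀ μ σ W hW) S := fun t =>
    ((adapted_price t).indicator (hCm t)).stronglyMeasurable
  have hSc : ∀ ω, Continuous fun t => S t ω := by
    intro ω
    by_cases hω : ω ∈ C
    · have : (fun t => S t ω) = fun t => price s₀ μ σ W t ω :=
        funext fun t => Set.indicator_of_mem hω _
      rw [this]
      have : Continuous fun t => W t ω := hω
      unfold price
      fun_prop
    · have : (fun t => S t ω) = fun _ => 0 := funext fun t => Set.indicator_of_notMem hω _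
      rw [this]
      exact continuous_const
  refine ⟨_, measurable_stoppedValue (hS.isStronglyProgressive_of_continuous hSc) hρ, ?_⟩
  filter_upwards [hB.continuous] with ω hω
  exact Set.indicator_of_mem (show ω ∈ C from hω) (price s₀ μ σ W (ρ ω))

variable [IsProbabilityMeasure P]

/-- There is no arbitrage by a single transaction between two stopping times. -/
theorem ae_mul_price_sub_eq_zero (hT : 0 < T) (hB : IsBrownianMotion P hT.le W) (hσ : σ ≠ 0)
    {ρ τ : Ω → Time T} (hρ : IsStoppingTime (priceFiltration P s₀ μ σ W hW)
    (fun ω => (ρ ω : WithTop (Time T))))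
    (hτ : IsStoppingTime (priceFiltration P s₀ μ σ W hW) (fun ω => (τ ω : WithTop (Time T))))
    (hρτ : ∀ ω, ρ ω ≤ τ ω) {ψ : Ω → ℝ} (hψ : Measurable[hρ.measurableSpace] ψ)
    (h : ∀ᵐ ω ∂P, 0 ≤ ψ ω * (price s₀ μ σ W (τ ω) ω - price s₀ μ σ W (ρ ω) ω)) :
    ∀ᵐ ω ∂P, ψ ω * (price s₀ μ σ W (τ ω) ω - price s₀ μ σ W (ρ ω) ω) = 0 := by
  set D : Ω → ℝ := fun ω => deflator hT.le μ σ W ω *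
    (price s₀ μ σ W (τ ω) ω - price s₀ μ σ W (ρ ω) ω) with hD
  obtain ⟨hρi, hρA⟩ := setIntegral_deflator_mul_price_stopped hT hB hσ hρ
  obtain ⟨hτi, hτA⟩ := setIntegral_deflator_mul_price_stopped hT hB hσ hτ
  have hle : hρ.measurableSpace ≤ hτ.measurableSpace :=
    hρ.measurableSpace_mono hτ fun ω => WithTop.coe_le_coe.2 (hρτ ω)
  have hDi : Integrable D P := by
    refine (hτi.sub hρi).congr (ae_of_all _ fun ω => ?_)
    simp only [hD, Pi.sub_apply]
    ring
  have hzero : ∀ A, MeasurableSet[hρ.measurableSpace] A → ∫ ω in A, D ω ∂P = 0 := by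
    intro A hA
    simp_rw [hD, mul_sub]
    rw [integral_sub hτi.integrableOn hρi.integrableOn, hρA A hA, hτA A (hle A hA), sub_self]
  have hpos : MeasurableSet[hρ.measurableSpace] {ω | 0 < ψ ω} := hψ measurableSet_Ioi
  have hneg : MeasurableSet[hρ.measurableSpace] {ω | ψ ω < 0} := hψ measurableSet_Iio
  have hposm := hρ.measurableSpace_le _ hpos
  have hnegm := hρ.measurableSpace_le _ hneg
  have h1 : D =ᵐ[P.restrict {ω | 0 < ψ ω}] 0 := by
    refine (setIntegral_eq_zero_iff_of_nonneg_ae ?_ hDi.integrableOn).1 (hzero _ hpos)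
    filter_upwards [ae_restrict_of_ae h, ae_restrict_mem hposm] with ω hω hω'
    exact mul_nonneg (deflator_pos hT.le ω).le (nonneg_of_mul_nonneg_right hω hω')
  have h2 : (fun ω => -D ω) =ᵐ[P.restrict {ω | ψ ω < 0}] 0 := by
    refine (setIntegral_eq_zero_iff_of_nonneg_ae ?_ hDi.neg.integrableOn).1 ?_
    · filter_upwards [ae_restrict_of_ae h, ae_restrict_mem hnegm] with ω hω hω'
      have : price s₀ μ σ W (τ ω) ω - price s₀ μ σ W (ρ ω) ω ≤ 0 := by
        by_contra! hc
        exact absurd hω (not_le.2 (mul_neg_of_neg_of_pos hω' hc))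
      exact neg_nonneg.2 (mul_nonpos_of_nonneg_of_nonpos (deflator_pos hT.le ω).le this)
    · rw [integral_neg', hzero _ hneg, neg_zero]
  have h1' := (ae_restrict_iff' hposm).1 h1
  have h2' := (ae_restrict_iff' hnegm).1 h2
  filter_upwards [h1', h2'] with ω hω1 hω2
  have hd := (deflator_pos (μ := μ) (σ := σ) (W := W) hT.le ω).ne'
  rcases lt_trichotomy (ψ ω) 0 with hψω | hψω | hψω
  · have := hω2 hψω
    simp only [Pi.zero_apply, neg_eq_zero, hD, mul_eq_zero, hd, false_or] at this
    rw [this, mul_zero]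
  · rw [hψω, zero_mul]
  · have := hω1 hψω
    simp only [Pi.zero_apply, hD, mul_eq_zero, hd, false_or] at this
    rw [this, mul_zero]

/-- There is no arbitrage by finitely many transactions at stopping times. -/
theorem ae_sum_mul_price_sub_eq_zero (hT : 0 < T) (hB : IsBrownianMotion P hT.le W) (hσ : σ ≠ 0)
    {τ : ℕ → Ω → Time T} (hτ : ∀ k, IsStoppingTime (priceFiltration P s₀ μ σ W hW)
    (fun ω => (τ k ω : WithTop (Time T)))) (hmono : ∀ ω, Monotone fun k => τ k ω)
    {φ : ℕ → Ω → ℝ} (hφ : ∀ k, Measurable[(hτ k).measurableSpace] (φ k)) (n : ℕ)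
    (h : ∀ᵐ ω ∂P, 0 ≤ ∑ k ∈ Finset.range n,
      φ k ω * (price s₀ μ σ W (τ (k + 1) ω) ω - price s₀ μ σ W (τ k ω) ω)) :
    ∀ᵐ ω ∂P, ∑ k ∈ Finset.range n,
      φ k ω * (price s₀ μ σ W (τ (k + 1) ω) ω - price s₀ μ σ W (τ k ω) ω) = 0 := by
  set D : ℕ → Ω → ℝ := fun k ω => price s₀ μ σ W (τ (k + 1) ω) ω - price s₀ μ σ W (τ k ω) ω
  have hle : ∀ j k, j ≤ k → (hτ j).measurableSpace ≤ (hτ k).measurableSpace := fun j k hjk =>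
    (hτ j).measurableSpace_mono (hτ k) fun ω => WithTop.coe_le_coe.2 (hmono ω hjk)
  choose X hXm hX using fun k => exists_measurable_ae_eq_stopped_price hB (hτ k)
  induction n with
  | zero => simp
  | succ n ih =>
    set Y : Ω → ℝ := fun ω => ∑ k ∈ Finset.range n, φ k ω * (X (k + 1) ω - X k ω)
    have hYm : Measurable[(hτ n).measurableSpace] Y := by
      refine Finset.measurable_fun_sum _ fun k hk => ?_
      have hk' := Finset.mem_range.1 hk
      exact ((hφ k).mono (hle k n (by omega)) le_rfl).mul
        (((hXm (k + 1)).mono (hle _ n (by omega)) le_rfl).sub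
          ((hXm k).mono (hle k n (by omega)) le_rfl))
    have hY : ∀ᵐ ω ∂P, Y ω = ∑ k ∈ Finset.range n, φ k ω * D k ω := by
      filter_upwards [ae_all_iff.2 hX] with ω hω
      refine Finset.sum_congr rfl fun k _ => ?_
      rw [hω, hω]
    have hA : MeasurableSet[(hτ n).measurableSpace] {ω | Y ω ≤ 0} := hYm measurableSet_Iic
    have hstep : ∀ᵐ ω ∂P, {ω | Y ω ≤ 0}.indicator (φ n) ω * D n ω = 0 := by
      refine ae_mul_price_sub_eq_zero hT hB hσ (hτ n) (hτ (n + 1))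
        (fun ω => hmono ω n.le_succ) ((hφ n).indicator hA) ?_
      filter_upwards [h, hY] with ω hω hYω
      rw [Finset.sum_range_succ, ← hYω] at hω
      by_cases hc : Y ω ≤ 0
      · rw [Set.indicator_of_mem (show ω ∈ {ω | Y ω ≤ 0} from hc)]
        linarith
      · rw [Set.indicator_of_notMem (show ω ∉ {ω | Y ω ≤ 0} from hc), zero_mul]
    have h0 : ∀ᵐ ω ∂P, 0 ≤ ∑ k ∈ Finset.range n, φ k ω * D k ω := by
      filter_upwards [h, hY, hstep] with ω hω hYω hs
      rw [Finset.sum_range_succ, ← hYω] at hω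
      rw [← hYω]
      by_contra! hc
      rw [Set.indicator_of_mem (show ω ∈ {ω | Y ω ≤ 0} from hc.le)] at hs
      have : φ n ω * D n ω = 0 := hs
      linarith
    filter_upwards [ih h0, hY, hstep] with ω hω hYω hs
    rw [Finset.sum_range_succ, hω, zero_add]
    rwa [Set.indicator_of_mem (show ω ∈ {ω | Y ω ≤ 0} from (hYω.trans hω).le)] at hs

end NoArbitrage

/-- A step function along nondecreasing times takes the value `φ k` at `τ (k + 1)` unless
`τ k = τ (k + 1)`. -/
theorem sum_indicator_Ioc_apply {τ : ℕ → Time T} (hτ : Monotone τ) (φ : ℕ → ℝ) (n : ℕ) {k : ℕ}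
    {t : Time T} (ht : t ∈ Set.Ioc (τ k) (τ (k + 1))) :
    ∑ j ∈ Finset.range n, (Set.Ioc (τ j) (τ (j + 1))).indicator (fun _ => φ j) t =
      if k < n then φ k else 0 := by
  have h : ∀ j, j ≠ k → (Set.Ioc (τ j) (τ (j + 1))).indicator (fun _ => φ j) t = 0 := by
    intro j hj
    refine Set.indicator_of_notMem (fun hjt => ?_) _
    rcases lt_or_gt_of_ne hj with hlt | hlt
    · exact absurd (hjt.2.trans (hτ (Nat.succ_le_of_lt hlt))) (not_le.2 ht.1)
    · exact absurd (ht.2.trans (hτ (Nat.succ_le_of_lt hlt))) (not_le.2 hjt.1)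
  split_ifs with hk
  · rw [Finset.sum_eq_single k (fun j _ hj => h j hj)
      (fun hk' => absurd (Finset.mem_range.2 hk) hk'), Set.indicator_of_mem ht]
  · exact Finset.sum_eq_zero fun j hj => h j (by have := Finset.mem_range.1 hj; omega)

theorem sum_indicator_Ioc_of_le {τ : ℕ → Time T} (hτ : Monotone τ) (φ : ℕ → ℝ) (n : ℕ)
    {t : Time T} (ht : t ≤ τ 0) :
    ∑ j ∈ Finset.range n, (Set.Ioc (τ j) (τ (j + 1))).indicator (fun _ => φ j) t = 0 :=
  Finset.sum_eq_zero fun j _ => Set.indicator_of_notMem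
    (fun hjt => absurd (ht.trans (hτ j.zero_le)) (not_le.2 hjt.1)) _

/-- The terminal value of a self-financing simple portfolio is the sum of its gains. -/
theorem ae_value_maturity_eq_sum {P : Measure Ω} {𝓕 : Filtration (Time T) m} {hT : 0 ≤ T}
    {S : Time T → Ω → ℝ} {Φ : Portfolio 𝓕} {n : ℕ} {τ : ℕ → Ω → Time T}
    (hn : ∀ k, n < k → ∀ ω, τ k ω = maturity hT) (hmono : ∀ ω, Monotone fun k => τ k ω)
    {φ₀ φ : ℕ → Ω → ℝ}
    (hbond : ∀ᵐ ω ∂P, ∀ t, Φ.bond t ω = ∑ k ∈ Finset.range n,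
      (Set.Ioc (τ k ω) (τ (k + 1) ω)).indicator (fun _ => φ₀ k ω) t)
    (hstock : ∀ᵐ ω ∂P, ∀ t, Φ.stock t ω = ∑ k ∈ Finset.range n,
      (Set.Ioc (τ k ω) (τ (k + 1) ω)).indicator (fun _ => φ k ω) t)
    (hsf : Φ.IsSelfFinancingAlong P S τ) :
    ∀ᵐ ω ∂P, Φ.value S (maturity hT) ω =
      ∑ k ∈ Finset.range n, φ k ω * (S (τ (k + 1) ω) ω - S (τ k ω) ω) := by
  filter_upwards [hbond, hstock, ae_all_iff.2 hsf] with ω hb hs hf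
  have h0 : Φ.value S (τ 0 ω) ω = 0 := by
    rw [Portfolio.value, hb, hs, sum_indicator_Ioc_of_le (hmono ω) (fun k => φ₀ k ω) n le_rfl,
      sum_indicator_Ioc_of_le (hmono ω) (fun k => φ k ω) n le_rfl]
    ring
  have hstep : ∀ k, Φ.value S (τ (k + 1) ω) ω - Φ.value S (τ k ω) ω =
      if k < n then φ k ω * (S (τ (k + 1) ω) ω - S (τ k ω) ω) else 0 := by
    intro k
    rw [hf k]
    rcases (hmono ω k.le_succ).eq_or_lt with he | hlt
    · have he' : τ k ω = τ (k + 1) ω := he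
      simp [he']
    · rw [hs, sum_indicator_Ioc_apply (hmono ω) (fun k => φ k ω) n ⟨hlt, le_rfl⟩, ite_mul, zero_mul]
  have hsum := Finset.sum_range_sub (fun k => Φ.value S (τ k ω) ω) (n + 1)
  rw [h0, sub_zero, hn (n + 1) n.lt_succ_self ω] at hsum
  rw [← hsum, Finset.sum_range_succ, hstep n, if_neg (lt_irrefl n), add_zero]
  refine Finset.sum_congr rfl fun k hk => ?_
  rw [hstep k, if_pos (Finset.mem_range.1 hk)]

theorem not_isArbitrage_of_mem_simple {P : Measure Ω} [IsProbabilityMeasure P] [P.IsComplete]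
    {s₀ μ σ : ℝ} {W : Time T → Ω → ℝ} {hW : ∀ t, Measurable (W t)} (hT : 0 < T)
    (hB : IsBrownianMotion P hT.le W) (hσ : σ ≠ 0)
    {Φ : Portfolio (priceFiltration P s₀ μ σ W hW)}
    (hΦ : Φ ∈ simple P (priceFiltration P s₀ μ σ W hW) hT.le (price s₀ μ σ W)) :
    ¬ Φ.IsArbitrage P hT.le (price s₀ μ σ W) := by
  rintro ⟨-, hnonneg, hpos⟩
  obtain ⟨n, τ, hn, ⟨hmono, hτ, φ₀, φ, -, hφ, hbond, hstock⟩, hsf⟩ := hΦ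
  have hval := ae_value_maturity_eq_sum hn hmono hbond hstock hsf
  have hzero := ae_sum_mul_price_sub_eq_zero hT hB hσ hτ hmono hφ n (by
    filter_upwards [hnonneg, hval] with ω h1 h2
    rwa [← h2])
  refine hpos.ne' (measure_mono_null (fun ω hω => ?_) (ae_iff.1 (hval.and hzero)))
  rintro ⟨h1, h2⟩
  exact absurd (h1.trans h2) (ne_of_gt hω)

/-! ### Portfolios readjusted at the times `T (1 - 2^{-k})` -/

theorem doublingTime_zero (hT : 0 ≤ T) : doublingTime hT 0 = initialTime hT :=
  Subtype.ext (by simp [doublingTime, initialTime])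

theorem strictMono_doublingTime (hT : 0 < T) : StrictMono (doublingTime hT.le) := by
  refine strictMono_nat_of_lt_succ fun k => ?_
  have h : (0 : ℝ) < (1 / 2) ^ k := by positivity
  change T * (1 - (1 / 2) ^ k) < T * (1 - (1 / 2) ^ (k + 1))
  rw [pow_succ]
  nlinarith

theorem doublingTime_lt_maturity (hT : 0 < T) (k : ℕ) :
    doublingTime hT.le k < maturity hT.le := by
  have h : (0 : ℝ) < (1 / 2) ^ k := by positivity
  change T * (1 - (1 / 2) ^ k) < T
  nlinarith

theorem exists_mem_Ioc_doublingTime (hT : 0 < T) {t : Time T} (h0 : initialTime hT.le < t)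
    (h1 : t < maturity hT.le) :
    ∃ k, t ∈ Set.Ioc (doublingTime hT.le k) (doublingTime hT.le (k + 1)) := by
  classical
  have hex : ∃ k, t ≤ doublingTime hT.le k := by
    have ht : (t : ℝ) < T := h1
    obtain ⟨k, hk⟩ := exists_pow_lt_of_lt_one (show 0 < (T - t) / T from
      div_pos (sub_pos.2 ht) hT) (show (1 / 2 : ℝ) < 1 by norm_num)
    refine ⟨k, ?_⟩
    rw [lt_div_iff₀ hT] at hk
    change (t : ℝ) ≤ T * (1 - (1 / 2) ^ k)
    linarith
  have hpos : Nat.find hex ≠ 0 := by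
    intro h
    have := Nat.find_spec hex
    rw [h, doublingTime_zero] at this
    exact absurd this (not_le.2 h0)
  obtain ⟨k, hk⟩ := Nat.exists_eq_succ_of_ne_zero hpos
  refine ⟨k, not_le.1 (Nat.find_min hex (by omega)), ?_⟩
  have := Nat.find_spec hex
  rwa [hk] at this

/-- The step function equal to `y k` on `(t_k, t_{k+1}]` and to `v` at time `T`. -/
noncomputable def stepPath (hT : 0 ≤ T) (y : ℕ → ℝ) (v : ℝ) (t : Time T) : ℝ :=
  (if t = maturity hT then v else 0) +
    ∑' k, (Set.Ioc (doublingTime hT k) (doublingTime hT (k + 1))).indicator (fun _ => y k) t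

theorem indicator_doublingTime_maturity (hT : 0 < T) (y : ℕ → ℝ) (k : ℕ) :
    (Set.Ioc (doublingTime hT.le k) (doublingTime hT.le (k + 1))).indicator (fun _ => y k)
      (maturity hT.le) = 0 :=
  Set.indicator_of_notMem (fun h => absurd h.2 (not_le.2 (doublingTime_lt_maturity hT _))) _

theorem stepPath_maturity (hT : 0 < T) (y : ℕ → ℝ) (v : ℝ) :
    stepPath hT.le y v (maturity hT.le) = v := by
  simp [stepPath, indicator_doublingTime_maturity hT]

theorem stepPath_initialTime (hT : 0 < T) (y : ℕ → ℝ) (v : ℝ) :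
    stepPath hT.le y v (initialTime hT.le) = 0 := by
  have h : ∀ k, (Set.Ioc (doublingTime hT.le k) (doublingTime hT.le (k + 1))).indicator
      (fun _ => y k) (initialTime hT.le) = 0 := fun k =>
    Set.indicator_of_notMem (fun h => absurd (initialTime_le hT.le _) (not_le.2 h.1)) _
  have h' : initialTime hT.le ≠ maturity hT.le := fun h => hT.ne (congrArg Subtype.val h)
  simp [stepPath, h, h']

theorem stepPath_of_mem (hT : 0 < T) (y : ℕ → ℝ) (v : ℝ) {k : ℕ} {t : Time T}
    (ht : t ∈ Set.Ioc (doublingTime hT.le k) (doublingTime hT.le (k + 1))) :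
    stepPath hT.le y v t = y k := by
  have h' : t ≠ maturity hT.le := (ht.2.trans_lt (doublingTime_lt_maturity hT _)).ne
  rw [stepPath, if_neg h', zero_add, tsum_eq_single k, Set.indicator_of_mem ht]
  intro j hj
  refine Set.indicator_of_notMem (fun hjt => ?_) _
  have hmono := (strictMono_doublingTime hT).monotone
  rcases lt_or_gt_of_ne hj with hlt | hlt
  · exact absurd (hjt.2.trans (hmono (Nat.succ_le_of_lt hlt))) (not_le.2 ht.1)
  · exact absurd (ht.2.trans (hmono (Nat.succ_le_of_lt hlt))) (not_le.2 hjt.1)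

theorem stepPath_doublingTime_succ (hT : 0 < T) (y : ℕ → ℝ) (v : ℝ) (k : ℕ) :
    stepPath hT.le y v (doublingTime hT.le (k + 1)) = y k :=
  stepPath_of_mem hT y v ⟨strictMono_doublingTime hT k.lt_succ_self, le_rfl⟩

theorem eq_or_mem_Ioc_doublingTime (hT : 0 < T) (t : Time T) :
    t = initialTime hT.le ∨ t = maturity hT.le ∨
      ∃ k, t ∈ Set.Ioc (doublingTime hT.le k) (doublingTime hT.le (k + 1)) := by
  rcases (initialTime_le hT.le t).eq_or_lt with h0 | h0
  · exact Or.inl h0.symm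
  rcases (le_maturity hT.le t).eq_or_lt with h1 | h1
  · exact Or.inr (Or.inl h1)
  · exact Or.inr (Or.inr (exists_mem_Ioc_doublingTime hT h0 h1))

theorem adapted_stepPath (hT : 0 < T) {𝓕 : Filtration (Time T) m} {y : ℕ → Ω → ℝ} {v : Ω → ℝ}
    (hy : ∀ k, Measurable[𝓕 (doublingTime hT.le k)] (y k))
    (hv : Measurable[𝓕 (maturity hT.le)] v) :
    Adapted 𝓕 fun t ω => stepPath hT.le (fun k => y k ω) (v ω) t := by
  intro t
  rcases eq_or_mem_Ioc_doublingTime hT t with rfl | rfl | ⟨k, hk⟩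
  · simp only [stepPath_initialTime hT]
    exact measurable_const
  · simpa only [stepPath_maturity hT] using hv
  · simp only [stepPath_of_mem hT _ _ hk]
    exact (hy k).mono (𝓕.mono hk.1.le) le_rfl

/-- The readjustment times `t_0, …, t_M, T, T, …`. -/
structure IsStoppedGrid (hT : 0 ≤ T) (M : ℕ) (τ : ℕ → Time T) : Prop where
  eq_doublingTime : ∀ k ≤ M, τ k = doublingTime hT k
  eq_maturity : ∀ k, M < k → τ k = maturity hT

theorem IsStoppedGrid.monotone (hT : 0 < T) {M : ℕ} {τ : ℕ → Time T}
    (h : IsStoppedGrid hT.le M τ) : Monotone τ := by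
  refine monotone_nat_of_le_succ fun k => ?_
  rcases Nat.lt_or_ge k M with hk | hk
  · rw [h.eq_doublingTime k hk.le, h.eq_doublingTime (k + 1) hk]
    exact (strictMono_doublingTime hT).monotone k.le_succ
  · rw [h.eq_maturity (k + 1) (by omega)]
    exact le_maturity hT.le _

theorem IsStoppedGrid.stepPath_eq_sum (hT : 0 < T) {M : ℕ} {τ : ℕ → Time T}
    (h : IsStoppedGrid hT.le M τ) {y : ℕ → ℝ} {v : ℝ} (hy : ∀ k, M ≤ k → y k = v) (t : Time T) :
    stepPath hT.le y v t = ∑ k ∈ Finset.range (M + 1),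
      (Set.Ioc (τ k) (τ (k + 1))).indicator (fun _ => y k) t := by
  have hlast : ∀ t, doublingTime hT.le M < t → ∑ k ∈ Finset.range (M + 1),
      (Set.Ioc (τ k) (τ (k + 1))).indicator (fun _ => y k) t = v := by
    intro t ht
    have hmem : t ∈ Set.Ioc (τ M) (τ (M + 1)) := by
      rw [h.eq_doublingTime M le_rfl, h.eq_maturity (M + 1) M.lt_succ_self]
      exact ⟨ht, le_maturity hT.le t⟩
    rw [sum_indicator_Ioc_apply (h.monotone hT) y (M + 1) hmem, if_pos M.lt_succ_self, hy M le_rfl]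
  rcases eq_or_mem_Ioc_doublingTime hT t with rfl | rfl | ⟨k, hk⟩
  · rw [stepPath_initialTime hT, sum_indicator_Ioc_of_le (h.monotone hT) y (M + 1)
      (initialTime_le hT.le _)]
  · rw [stepPath_maturity hT, hlast _ (doublingTime_lt_maturity hT M)]
  · rw [stepPath_of_mem hT _ _ hk]
    rcases Nat.lt_or_ge k M with hkM | hkM
    · have hmem : t ∈ Set.Ioc (τ k) (τ (k + 1)) := by
        rwa [h.eq_doublingTime k hkM.le, h.eq_doublingTime (k + 1) hkM]
      rw [sum_indicator_Ioc_apply (h.monotone hT) y (M + 1) hmem, if_pos (by omega)]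
    · rw [hlast t (((strictMono_doublingTime hT).monotone hkM).trans_lt hk.1), hy k hkM]

/-- The gains up to time `t_k` of holding `x j` shares during `(t_j, t_{j+1}]`. -/
noncomputable def gains (hT : 0 ≤ T) (S : Time T → Ω → ℝ) (x : ℕ → Ω → ℝ) (k : ℕ) (ω : Ω) : ℝ :=
  ∑ j ∈ Finset.range k, x j ω * (S (doublingTime hT (j + 1)) ω - S (doublingTime hT j) ω)

theorem gains_succ (hT : 0 ≤ T) (S : Time T → Ω → ℝ) (x : ℕ → Ω → ℝ) (k : ℕ) (ω : Ω) :
    gains hT S x (k + 1) ω = gains hT S x k ω +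
      x k ω * (S (doublingTime hT (k + 1)) ω - S (doublingTime hT k) ω) :=
  Finset.sum_range_succ _ _

theorem gains_eq_of_le {hT : 0 ≤ T} {S : Time T → Ω → ℝ} {x : ℕ → Ω → ℝ} {M : ℕ} {ω : Ω}
    (hx : ∀ k, M ≤ k → x k ω = 0) {k : ℕ} (hk : M ≤ k) :
    gains hT S x k ω = gains hT S x M ω := by
  induction k, hk using Nat.le_induction with
  | base => rfl
  | succ k hk ih => rw [gains_succ, ih, hx k hk, zero_mul, add_zero]

theorem measurable_gains (hT : 0 < T) {𝓕 : Filtration (Time T) m} {S : Time T → Ω → ℝ}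
    (hS : Adapted 𝓕 S) {x : ℕ → Ω → ℝ}
    (hx : ∀ k, Measurable[𝓕 (doublingTime hT.le k)] (x k)) (k : ℕ) :
    Measurable[𝓕 (doublingTime hT.le k)] (gains hT.le S x k) := by
  have hmono := (strictMono_doublingTime hT).monotone
  refine Finset.measurable_fun_sum _ fun j hj => ?_
  have hj' := Finset.mem_range.1 hj
  exact ((hx j).mono (𝓕.mono (hmono (by omega))) le_rfl).mul
    (((hS _).mono (𝓕.mono (hmono (by omega))) le_rfl).sub
      ((hS _).mono (𝓕.mono (hmono (by omega))) le_rfl))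

/-- The self-financing portfolio holding `x k` shares during `(t_k, t_{k+1}]`, and no shares and
`v` bonds at time `T`. -/
noncomputable def gridPortfolio (hT : 0 < T) {𝓕 : Filtration (Time T) m} {S : Time T → Ω → ℝ}
    (hS : Adapted 𝓕 S) (x : ℕ → Ω → ℝ) (hx : ∀ k, Measurable[𝓕 (doublingTime hT.le k)] (x k))
    (v : Ω → ℝ) (hv : Measurable[𝓕 (maturity hT.le)] v) : Portfolio 𝓕 where
  bond t ω := stepPath hT.le
    (fun k => gains hT.le S x k ω - x k ω * S (doublingTime hT.le k) ω) (v ω) t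
  stock t ω := stepPath hT.le (fun k => x k ω) 0 t
  adapted_bond := adapted_stepPath hT
    (fun k => (measurable_gains hT hS hx k).sub ((hx k).mul (hS _))) hv
  adapted_stock := adapted_stepPath hT hx measurable_const

section GridPortfolio

variable {hT : 0 < T} {𝓕 : Filtration (Time T) m} {S : Time T → Ω → ℝ} {hS : Adapted 𝓕 S}
  {x : ℕ → Ω → ℝ} {hx : ∀ k, Measurable[𝓕 (doublingTime hT.le k)] (x k)}
  {v : Ω → ℝ} {hv : Measurable[𝓕 (maturity hT.le)] v}

theorem gridPortfolio_value_maturity (ω : Ω) :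
    (gridPortfolio hT hS x hx v hv).value S (maturity hT.le) ω = v ω := by
  simp [Portfolio.value, gridPortfolio, stepPath_maturity hT]

theorem gridPortfolio_value_initialTime (ω : Ω) :
    (gridPortfolio hT hS x hx v hv).value S (initialTime hT.le) ω = 0 := by
  simp [Portfolio.value, gridPortfolio, stepPath_initialTime hT]

theorem gridPortfolio_value_doublingTime (k : ℕ) (ω : Ω) :
    (gridPortfolio hT hS x hx v hv).value S (doublingTime hT.le k) ω = gains hT.le S x k ω := by
  rcases k with _ | k
  · rw [doublingTime_zero, gridPortfolio_value_initialTime]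
    rfl
  · simp only [Portfolio.value, gridPortfolio, stepPath_doublingTime_succ hT, gains_succ]
    ring

/-- A grid portfolio whose share holdings vanish from a (random) index on is a self-financing step
portfolio along the stopped grid. -/
theorem gridPortfolio_isStepAlong {P : Measure Ω} {E : ℕ → Set Ω}
    (hE : ∀ k, MeasurableSet[𝓕 (doublingTime hT.le k)] (E k)) (hEmono : Monotone E)
    {τ : ℕ → Ω → Time T} (hτE : ∀ k, ∀ ω ∈ E k, τ k ω = maturity hT.le)
    (hτE' : ∀ k, ∀ ω ∉ E k, τ k ω = doublingTime hT.le k) {N : Ω → ℕ}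
    (h : ∀ᵐ ω ∂P, ∃ M, N ω = M + 1 ∧ (∀ k, ω ∈ E k ↔ M < k) ∧ (∀ k, M ≤ k → x k ω = 0) ∧
      v ω = gains hT.le S x M ω) :
    (gridPortfolio hT hS x hx v hv).IsStepAlong P τ N ∧
      (gridPortfolio hT hS x hx v hv).IsSelfFinancingAlong P S τ := by
  classical
  have hmono : ∀ ω, Monotone fun k => τ k ω := by
    refine fun ω => monotone_nat_of_le_succ fun k => ?_
    by_cases h1 : ω ∈ E (k + 1)
    · rw [hτE _ ω h1]
      exact le_maturity hT.le _
    · rw [hτE' _ ω h1, hτE' _ ω fun hk => h1 (hEmono k.le_succ hk)]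
      exact (strictMono_doublingTime hT).monotone k.le_succ
  have hτ : ∀ k, IsStoppingTime 𝓕 (fun ω => (τ k ω : WithTop (Time T))) := by
    intro k
    have := isStoppingTime_piecewise_const (𝒢 := 𝓕) (doublingTime_lt_maturity hT k).le (hE k).compl
    convert this using 1
    ext1 ω
    by_cases hω : ω ∈ E k
    · rw [Set.piecewise_eq_of_notMem _ _ _ (Set.notMem_compl_iff.2 hω), hτE k ω hω]
    · rw [Set.piecewise_eq_of_mem _ _ _ (Set.mem_compl hω), hτE' k ω hω]
  have hle : ∀ k, 𝓕 (doublingTime hT.le k) ≤ (hτ k).measurableSpace := by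
    refine fun k => (hτ k).le_measurableSpace_of_const_le fun ω => WithTop.coe_le_coe.2 ?_
    by_cases hω : ω ∈ E k
    · rw [hτE k ω hω]
      exact le_maturity hT.le _
    · rw [hτE' k ω hω]
  have hgrid : ∀ ω M, (∀ k, ω ∈ E k ↔ M < k) → IsStoppedGrid hT.le M fun k => τ k ω :=
    fun ω M hM => ⟨fun k hk => hτE' k ω fun hω => absurd ((hM k).1 hω) (not_lt.2 hk),
      fun k hk => hτE k ω ((hM k).2 hk)⟩
  refine ⟨⟨hmono, hτ, fun k ω => gains hT.le S x k ω - x k ω * S (doublingTime hT.le k) ω, x,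
    fun k => ((measurable_gains hT hS hx k).sub ((hx k).mul (hS _))).mono (hle k) le_rfl,
    fun k => (hx k).mono (hle k) le_rfl, ?_, ?_⟩, ?_⟩
  · filter_upwards [h] with ω ⟨M, hN, hM, hxM, hvM⟩ t
    rw [hN]
    refine (hgrid ω M hM).stepPath_eq_sum hT (fun k hk => ?_) t
    rw [hxM k hk, zero_mul, sub_zero, gains_eq_of_le hxM hk, hvM]
  · filter_upwards [h] with ω ⟨M, hN, hM, hxM, hvM⟩ t
    rw [hN]
    exact (hgrid ω M hM).stepPath_eq_sum hT hxM t
  · intro k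
    filter_upwards [h] with ω ⟨M, hN, hM, hxM, hvM⟩
    have hg := hgrid ω M hM
    rcases lt_trichotomy k M with hk | rfl | hk
    · rw [hg.eq_doublingTime k hk.le, hg.eq_doublingTime (k + 1) hk,
        gridPortfolio_value_doublingTime, gridPortfolio_value_doublingTime, gains_succ]
      simp only [gridPortfolio, stepPath_doublingTime_succ hT]
      ring
    · rw [hg.eq_doublingTime k le_rfl, hg.eq_maturity (k + 1) k.lt_succ_self,
        gridPortfolio_value_doublingTime, gridPortfolio_value_maturity, hvM]
      simp [gridPortfolio, stepPath_maturity hT]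
    · rw [hg.eq_maturity k hk, hg.eq_maturity (k + 1) (by omega)]
      simp

end GridPortfolio

/-! ### The doubling strategy -/

/-- The return over `(t_k, t_{k+1}]` reaches the threshold. -/
def winSet (hT : 0 ≤ T) (S : Time T → Ω → ℝ) (c : ℕ → ℝ) (k : ℕ) : Set Ω :=
  {ω | c (k + 1) ≤ (S (doublingTime hT (k + 1)) ω - S (doublingTime hT k) ω) /
    S (doublingTime hT k) ω}

/-- The threshold has been reached at some `t_j` with `1 ≤ j ≤ k`. -/
def wonSet (hT : 0 ≤ T) (S : Time T → Ω → ℝ) (c : ℕ → ℝ) (k : ℕ) : Set Ω :=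
  ⋃ j ∈ Finset.range k, winSet hT S c j

/-- The wealth at time `t_k` of the doubling strategy. -/
noncomputable def doublingWealth (hT : 0 ≤ T) (S : Time T → Ω → ℝ) (c : ℕ → ℝ) : ℕ → Ω → ℝ
  | 0, _ => 0
  | k + 1, ω => doublingWealth hT S c k ω + (wonSet hT S c k)ᶜ.indicator
      (fun ω => (1 - doublingWealth hT S c k ω) / (S (doublingTime hT k) ω * c (k + 1))) ω *
      (S (doublingTime hT (k + 1)) ω - S (doublingTime hT k) ω)

/-- The number of shares held by the doubling strategy during `(t_k, t_{k+1}]`. -/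
noncomputable def doublingShares (hT : 0 ≤ T) (S : Time T → Ω → ℝ) (c : ℕ → ℝ) (k : ℕ) :
    Ω → ℝ :=
  (wonSet hT S c k)ᶜ.indicator
    fun ω => (1 - doublingWealth hT S c k ω) / (S (doublingTime hT k) ω * c (k + 1))

section Doubling

variable {S : Time T → Ω → ℝ} {c : ℕ → ℝ}

theorem gains_doublingShares (hT : 0 < T) (k : ℕ) (ω : Ω) :
    gains hT.le S (doublingShares hT.le S c) k ω = doublingWealth hT.le S c k ω := by
  induction k with
  | zero => rfl
  | succ k ih => rw [gains_succ, ih]; rfl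

theorem monotone_wonSet (hT : 0 < T) : Monotone (wonSet hT.le S c) := fun _ _ hij =>
  Set.biUnion_subset_biUnion_left fun _ hl =>
    Finset.mem_range.2 ((Finset.mem_range.1 hl).trans_le hij)

theorem measurableSet_wonSet (hT : 0 < T) {𝓕 : Filtration (Time T) m} (hS : Adapted 𝓕 S) (k : ℕ) :
    MeasurableSet[𝓕 (doublingTime hT.le k)] (wonSet hT.le S c k) := by
  have hmono := (strictMono_doublingTime hT).monotone
  refine Finset.measurableSet_biUnion _ fun j hj => ?_
  have hj' := Finset.mem_range.1 hj
  have h1 : Measurable[𝓕 (doublingTime hT.le k)] (S (doublingTime hT.le j)) :=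
    (hS _).mono (𝓕.mono (hmono (by omega))) le_rfl
  have h2 : Measurable[𝓕 (doublingTime hT.le k)] (S (doublingTime hT.le (j + 1))) :=
    (hS _).mono (𝓕.mono (hmono (by omega))) le_rfl
  exact ((h2.sub h1).div h1) measurableSet_Ici

theorem measurable_doublingWealth (hT : 0 < T) {𝓕 : Filtration (Time T) m} (hS : Adapted 𝓕 S)
    (k : ℕ) : Measurable[𝓕 (doublingTime hT.le k)] (doublingWealth hT.le S c k) := by
  induction k with
  | zero => exact measurable_const
  | succ k ih =>
    have hle : 𝓕 (doublingTime hT.le k) ≤ 𝓕 (doublingTime hT.le (k + 1)) :=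
      𝓕.mono ((strictMono_doublingTime hT).monotone k.le_succ)
    have hs : Measurable[𝓕 (doublingTime hT.le k)] (doublingShares hT.le S c k) :=
      Measurable.indicator ((measurable_const.sub ih).div ((hS _).mul measurable_const))
        (measurableSet_wonSet hT hS k).compl
    exact (ih.mono hle le_rfl).add ((hs.mono hle le_rfl).mul
      ((hS _).sub ((hS _).mono hle le_rfl)))

theorem measurable_doublingShares (hT : 0 < T) {𝓕 : Filtration (Time T) m} (hS : Adapted 𝓕 S)
    (k : ℕ) : Measurable[𝓕 (doublingTime hT.le k)] (doublingShares hT.le S c k) :=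
  Measurable.indicator
    ((measurable_const.sub (measurable_doublingWealth hT hS k)).div ((hS _).mul measurable_const))
    (measurableSet_wonSet hT hS k).compl

theorem mem_wonSet_iff (hT : 0 < T) {ω : Ω} {j : ℕ} (hj : ω ∈ winSet hT.le S c j)
    (hmin : ∀ i < j, ω ∉ winSet hT.le S c i) (k : ℕ) : ω ∈ wonSet hT.le S c k ↔ j < k := by
  simp only [wonSet, Finset.mem_range, Set.mem_iUnion, exists_prop]
  constructor
  · rintro ⟨i, hik, hi⟩
    by_contra! hc
    exact hmin i (hik.trans_le hc) hi
  · exact fun h => ⟨j, h, hj⟩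

/-- The stopping rule of the doubling strategy at the first win. -/
theorem doublingStop_eq (hT : 0 < T) {ω : Ω} {j : ℕ} (hj : ω ∈ winSet hT.le S c j)
    (hmin : ∀ i < j, ω ∉ winSet hT.le S c i) :
    doublingStop hT.le S c ω = doublingTime hT.le (j + 1) := by
  refine IsLeast.csInf_eq ⟨Or.inr ⟨j, rfl, hj⟩, ?_⟩
  rintro y (rfl | ⟨i, rfl, hi⟩)
  · exact (doublingTime_lt_maturity hT (j + 1)).le
  · have : j ≤ i := by
      by_contra! hc
      exact hmin i hc hi
    exact (strictMono_doublingTime hT).monotone (by omega)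

theorem doublingTerm_eq (hT : 0 < T) {𝓕 : Filtration (Time T) m} {Φ : Portfolio 𝓕} {ω : Ω} {j : ℕ}
    (hj : ω ∈ winSet hT.le S c j) (hmin : ∀ i < j, ω ∉ winSet hT.le S c i) {k : ℕ}
    (hΦ : Φ.value S (doublingTime hT.le k) ω = doublingWealth hT.le S c k ω) (t : Time T) :
    doublingTerm hT.le S c Φ k t ω =
      (Set.Ioc (doublingTime hT.le k) (doublingTime hT.le (k + 1))).indicator
        (fun _ => doublingShares hT.le S c k ω) t := by
  have hmono : ∀ a b, a ≤ b → (doublingTime hT.le a : ℝ) ≤ doublingTime hT.le b :=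
    fun a b hab => (strictMono_doublingTime hT).monotone hab
  rw [doublingTerm, doublingStop_eq hT hj hmin, hΦ]
  rcases Nat.lt_or_ge j k with hk | hk
  · rw [min_eq_right (hmono _ _ (by omega)), min_eq_right (hmono _ _ (by omega)), Set.Ioc_self,
      Set.indicator_empty, doublingShares,
      Set.indicator_of_notMem (Set.notMem_compl_iff.2 ((mem_wonSet_iff hT hj hmin k).2 hk))]
    simp
  · have hnot : ω ∉ wonSet hT.le S c k := fun h =>
      absurd ((mem_wonSet_iff hT hj hmin k).1 h) (not_lt.2 hk)
    rw [min_eq_left (hmono _ _ (by omega)), min_eq_left (hmono _ _ (by omega)), doublingShares,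
      Set.indicator_of_mem (Set.mem_compl hnot)]
    rfl

/-- Before the first win the wealth stays below `1`. -/
theorem doublingWealth_lt_one (hT : 0 < T) (hSpos : ∀ t ω, 0 < S t ω) (hc : ∀ k, 0 < c k)
    {ω : Ω} {j : ℕ} (hmin : ∀ i < j, ω ∉ winSet hT.le S c i) :
    doublingWealth hT.le S c j ω < 1 := by
  induction j with
  | zero => exact zero_lt_one
  | succ j ih =>
    have hlt := ih fun i hi => hmin i (by omega)
    have hnot : ω ∉ wonSet hT.le S c j := by
      simp only [wonSet, Finset.mem_range, Set.mem_iUnion, not_exists]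
      exact fun i hi => hmin i (by omega)
    have hw : ω ∉ winSet hT.le S c j := hmin j j.lt_succ_self
    simp only [winSet, Set.mem_ofPred_eq, not_le] at hw
    have hS := hSpos (doublingTime hT.le j) ω
    rw [div_lt_iff₀ hS] at hw
    rw [doublingWealth, Set.indicator_of_mem (Set.mem_compl hnot), div_mul_eq_mul_div,
      ← lt_sub_iff_add_lt', div_lt_iff₀ (mul_pos hS (hc _))]
    rw [mul_comm (S _ ω) (c _)]
    exact mul_lt_mul_of_pos_left hw (by linarith)

/-- At the first win the wealth reaches `1`. -/
theorem one_le_doublingWealth (hT : 0 < T) (hSpos : ∀ t ω, 0 < S t ω) (hc : ∀ k, 0 < c k)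
    {ω : Ω} {j : ℕ} (hj : ω ∈ winSet hT.le S c j) (hmin : ∀ i < j, ω ∉ winSet hT.le S c i) :
    1 ≤ doublingWealth hT.le S c (j + 1) ω := by
  have hlt := doublingWealth_lt_one hT hSpos hc hmin
  have hnot : ω ∉ wonSet hT.le S c j := by
    simp only [wonSet, Finset.mem_range, Set.mem_iUnion, not_exists]
    exact fun i hi => hmin i hi
  have hS := hSpos (doublingTime hT.le j) ω
  simp only [winSet, Set.mem_ofPred_eq] at hj
  rw [le_div_iff₀ hS] at hj
  rw [doublingWealth, Set.indicator_of_mem (Set.mem_compl hnot), div_mul_eq_mul_div,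
    ← sub_le_iff_le_add', le_div_iff₀ (mul_pos hS (hc _)), mul_comm (S _ ω) (c _)]
  exact mul_le_mul_of_nonneg_left hj (by linarith)

theorem doublingShares_eq_zero (hT : 0 < T) {ω : Ω} {j : ℕ} (hj : ω ∈ winSet hT.le S c j)
    (hmin : ∀ i < j, ω ∉ winSet hT.le S c i) (k : ℕ) (hk : j + 1 ≤ k) :
    doublingShares hT.le S c k ω = 0 :=
  Set.indicator_of_notMem (Set.notMem_compl_iff.2 ((mem_wonSet_iff hT hj hmin k).2 hk)) _

theorem doublingWealth_eq (hT : 0 < T) {ω : Ω} {j : ℕ} (hj : ω ∈ winSet hT.le S c j)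
    (hmin : ∀ i < j, ω ∉ winSet hT.le S c i) (k : ℕ) (hk : j + 1 ≤ k) :
    doublingWealth hT.le S c k ω = doublingWealth hT.le S c (j + 1) ω := by
  rw [← gains_doublingShares hT, ← gains_doublingShares hT,
    gains_eq_of_le (doublingShares_eq_zero hT hj hmin) hk]

/-- The doubling strategy truncated after the summand with index `n`. -/
noncomputable def truncatedShares (hT : 0 ≤ T) (S : Time T → Ω → ℝ) (c : ℕ → ℝ) (n k : ℕ) (ω : Ω) :
    ℝ :=
  if k ≤ n then doublingShares hT S c k ω else 0

theorem measurable_truncatedShares (hT : 0 < T) {𝓕 : Filtration (Time T) m} (hS : Adapted 𝓕 S)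
    (n k : ℕ) : Measurable[𝓕 (doublingTime hT.le k)] (truncatedShares hT.le S c n k) := by
  unfold truncatedShares
  split_ifs
  · exact measurable_doublingShares hT hS k
  · exact measurable_const

theorem gains_truncatedShares (hT : 0 < T) (n : ℕ) (ω : Ω) :
    gains hT.le S (truncatedShares hT.le S c n) (n + 1) ω =
      doublingWealth hT.le S c (n + 1) ω := by
  rw [← gains_doublingShares hT]
  refine Finset.sum_congr rfl fun k hk => ?_
  rw [truncatedShares, if_pos (Nat.lt_succ_iff.1 (Finset.mem_range.1 hk))]

/-- The portfolio of the doubling strategy. -/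
noncomputable def doublingPortfolio (hT : 0 < T) {𝓕 : Filtration (Time T) m} (hS : Adapted 𝓕 S)
    (c : ℕ → ℝ) : Portfolio 𝓕 :=
  gridPortfolio hT hS (doublingShares hT.le S c) (measurable_doublingShares hT hS)
    (fun ω => limsup (fun k => doublingWealth hT.le S c k ω) atTop)
    (Measurable.limsup fun k => (measurable_doublingWealth hT hS k).mono
      (𝓕.mono (le_maturity hT.le _)) le_rfl)

/-- The portfolio of the truncated doubling strategy. -/
noncomputable def truncatedPortfolio (hT : 0 < T) {𝓕 : Filtration (Time T) m} (hS : Adapted 𝓕 S)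
    (c : ℕ → ℝ) (n : ℕ) : Portfolio 𝓕 :=
  gridPortfolio hT hS (truncatedShares hT.le S c n) (measurable_truncatedShares hT hS n)
    (doublingWealth hT.le S c (n + 1))
    ((measurable_doublingWealth hT hS (n + 1)).mono (𝓕.mono (le_maturity hT.le _)) le_rfl)

theorem limsup_doublingWealth (hT : 0 < T) {ω : Ω} {j : ℕ} (hj : ω ∈ winSet hT.le S c j)
    (hmin : ∀ i < j, ω ∉ winSet hT.le S c i) :
    limsup (fun k => doublingWealth hT.le S c k ω) atTop = doublingWealth hT.le S c (j + 1) ω :=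
  (tendsto_const_nhds.congr' (eventually_atTop.2 ⟨j + 1, fun k hk =>
    (doublingWealth_eq hT hj hmin k hk).symm⟩)).limsup_eq

variable {P : Measure Ω} {𝓕 : Filtration (Time T) m}

theorem exists_first_win (hT : 0 < T) (h : ∀ᵐ ω ∂P, ∃ k, ω ∈ winSet hT.le S c k) :
    ∀ᵐ ω ∂P, ∃ j, ω ∈ winSet hT.le S c j ∧ ∀ i < j, ω ∉ winSet hT.le S c i := by
  classical
  filter_upwards [h] with ω hω
  exact ⟨Nat.find hω, Nat.find_spec hω, fun i hi => Nat.find_min hω hi⟩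

theorem truncatedPortfolio_mem_simple (hT : 0 < T) (hS : Adapted 𝓕 S) (c : ℕ → ℝ) (n : ℕ) :
    truncatedPortfolio hT hS c n ∈ simple P 𝓕 hT.le S := by
  classical
  refine ⟨n + 2, fun k _ => if n + 1 < k then maturity hT.le else doublingTime hT.le k,
    fun k hk ω => if_pos (by omega), ?_⟩
  refine gridPortfolio_isStepAlong (E := fun k => {_ω | n + 1 < k}) (fun k => MeasurableSet.const _)
    (fun i j hij ω (hω : n + 1 < i) => show n + 1 < j by omega)
    (fun k ω hω => if_pos hω) (fun k ω hω => if_neg hω)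
    (ae_of_all _ fun ω => ⟨n + 1, rfl, fun k => Iff.rfl, fun k hk => if_neg (by omega), ?_⟩)
  exact (gains_truncatedShares hT n ω).symm

theorem doublingPortfolio_mem_almostSimple (hT : 0 < T) (hS : Adapted 𝓕 S) {c : ℕ → ℝ}
    (h : ∀ᵐ ω ∂P, ∃ k, ω ∈ winSet hT.le S c k) :
    doublingPortfolio hT hS c ∈ almostSimple P 𝓕 hT.le S := by
  classical
  set E : ℕ → Set Ω := fun k => wonSet hT.le S c (k - 1) with hEdef
  have hE : ∀ k, MeasurableSet[𝓕 (doublingTime hT.le k)] (E k) := fun k =>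
    𝓕.mono ((strictMono_doublingTime hT).monotone (k.sub_le 1)) _ (measurableSet_wonSet hT hS _)
  have hEmono : Monotone E := fun i j hij => monotone_wonSet hT (by omega)
  have hEiff : ∀ ω j, ω ∈ winSet hT.le S c j → (∀ i < j, ω ∉ winSet hT.le S c i) →
      ∀ k, ω ∈ E k ↔ j + 1 < k := by
    intro ω j hj hmin k
    rw [hEdef]
    simp only
    rw [mem_wonSet_iff hT hj hmin]
    omega
  have hp : ∀ ω, ∃ k, ω ∈ E k ∨ ω ∉ ⋃ i, E i := by
    intro ω
    by_cases hω : ω ∈ ⋃ i, E i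
    · obtain ⟨k, hk⟩ := Set.mem_iUnion.1 hω
      exact ⟨k, Or.inl hk⟩
    · exact ⟨0, Or.inr hω⟩
  have hEm : ∀ k, MeasurableSet (E k) := fun k => 𝓕.le _ _ (hE k)
  refine ⟨fun k ω => if ω ∈ E k then maturity hT.le else doublingTime hT.le k,
    fun ω => Nat.find (hp ω), ?_, ?_, ?_⟩
  · filter_upwards [exists_first_win hT h] with ω ⟨j, hj, hmin⟩
    exact ⟨j + 2, if_pos ((hEiff ω j hj hmin _).2 (by omega))⟩
  · exact measurable_find hp fun k => (hEm k).union (MeasurableSet.iUnion hEm).compl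
  · refine gridPortfolio_isStepAlong hE hEmono (fun k ω hω => if_pos hω)
      (fun k ω hω => if_neg hω) ?_
    filter_upwards [exists_first_win hT h] with ω ⟨j, hj, hmin⟩
    have hiff := hEiff ω j hj hmin
    refine ⟨j + 1, ?_, hiff, doublingShares_eq_zero hT hj hmin, ?_⟩
    · rw [Nat.find_eq_iff]
      have hU : ω ∈ ⋃ i, E i := Set.mem_iUnion.2 ⟨j + 2, (hiff _).2 (by omega)⟩
      refine ⟨Or.inl ((hiff _).2 (by omega)), fun k hk => ?_⟩
      rintro (hk' | hk')
      · have := (hiff k).1 hk'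
        omega
      · exact hk' hU
    · rw [limsup_doublingWealth hT hj hmin, gains_doublingShares hT]

theorem doublingPortfolio_isDoubling (hT : 0 < T) (hS : Adapted 𝓕 S) {c : ℕ → ℝ}
    (h : ∀ᵐ ω ∂P, ∃ k, ω ∈ winSet hT.le S c k) :
    (doublingPortfolio hT hS c).IsDoubling P hT.le S c := by
  filter_upwards [exists_first_win hT h] with ω ⟨j, hj, hmin⟩ t
  have hval : ∀ k, (doublingPortfolio hT hS c).value S (doublingTime hT.le k) ω =
      doublingWealth hT.le S c k ω := fun k =>
    (gridPortfolio_value_doublingTime k ω).trans (gains_doublingShares hT k ω)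
  simp_rw [doublingTerm_eq hT hj hmin (hval _)]
  simp [doublingPortfolio, gridPortfolio, stepPath]

theorem truncatedPortfolio_isTruncatedDoubling (hT : 0 < T) (hS : Adapted 𝓕 S) {c : ℕ → ℝ}
    (h : ∀ᵐ ω ∂P, ∃ k, ω ∈ winSet hT.le S c k) (n : ℕ) :
    (truncatedPortfolio hT hS c n).IsTruncatedDoubling (doublingPortfolio hT hS c) P hT.le S c
      n := by
  filter_upwards [exists_first_win hT h] with ω ⟨j, hj, hmin⟩ t
  have hval : ∀ k, (doublingPortfolio hT hS c).value S (doublingTime hT.le k) ω =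
      doublingWealth hT.le S c k ω := fun k =>
    (gridPortfolio_value_doublingTime k ω).trans (gains_doublingShares hT k ω)
  simp_rw [doublingTerm_eq hT hj hmin (hval _)]
  simp only [truncatedPortfolio, gridPortfolio, stepPath, ite_self, zero_add]
  rw [tsum_eq_sum (s := Finset.range (n + 1))]
  · refine Finset.sum_congr rfl fun k hk => ?_
    rw [truncatedShares, if_pos (Nat.lt_succ_iff.1 (Finset.mem_range.1 hk))]
  · intro k hk
    rw [truncatedShares, if_neg (fun h => hk (Finset.mem_range.2 (Nat.lt_succ_iff.2 h)))]
    simp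

theorem doublingPortfolio_isStrongArbitrage (hT : 0 < T) (hS : Adapted 𝓕 S)
    (hSpos : ∀ t ω, 0 < S t ω) {c : ℕ → ℝ} (hc : ∀ k, 0 < c k)
    (h : ∀ᵐ ω ∂P, ∃ k, ω ∈ winSet hT.le S c k) :
    (doublingPortfolio hT hS c).IsStrongArbitrage P hT.le S := by
  refine ⟨ae_of_all _ gridPortfolio_value_initialTime, 1, zero_lt_one, ?_⟩
  filter_upwards [exists_first_win hT h] with ω ⟨j, hj, hmin⟩
  rw [doublingPortfolio, gridPortfolio_value_maturity, limsup_doublingWealth hT hj hmin]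
  exact one_le_doublingWealth hT hSpos hc hj hmin

theorem truncatedPortfolio_isStrongApproximateArbitrage [IsProbabilityMeasure P] (hT : 0 < T)
    (hS : Adapted 𝓕 S) (hSpos : ∀ t ω, 0 < S t ω) {c : ℕ → ℝ} (hc : ∀ k, 0 < c k)
    (h : ∀ᵐ ω ∂P, ∃ k, ω ∈ winSet hT.le S c k) :
    IsStrongApproximateArbitrage (truncatedPortfolio hT hS c) P hT.le S := by
  have hm : ∀ k, Measurable (doublingWealth hT.le S c k) := fun k =>
    (measurable_doublingWealth hT hS k).mono (𝓕.le _) le_rfl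
  have hone : ∀ᵐ ω ∂P, 1 ≤ limsup (fun k => doublingWealth hT.le S c k ω) atTop := by
    filter_upwards [exists_first_win hT h] with ω ⟨j, hj, hmin⟩
    rw [limsup_doublingWealth hT hj hmin]
    exact one_le_doublingWealth hT hSpos hc hj hmin
  have hval : ∀ n, (truncatedPortfolio hT hS c n).value S (maturity hT.le) =
      doublingWealth hT.le S c (n + 1) := fun n => funext gridPortfolio_value_maturity
  refine ⟨fun ω => limsup (fun k => doublingWealth hT.le S c k ω) atTop,
    ⟨fun n => ae_of_all _ gridPortfolio_value_initialTime, Measurable.limsup hm, ?_, ?_, ?_⟩,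
    1, zero_lt_one, hone⟩
  · simp_rw [hval]
    refine tendstoInMeasure_of_tendsto_ae (fun n => (hm _).aestronglyMeasurable) ?_
    filter_upwards [exists_first_win hT h] with ω ⟨j, hj, hmin⟩
    rw [limsup_doublingWealth hT hj hmin]
    exact tendsto_const_nhds.congr' (eventually_atTop.2 ⟨j, fun k hk =>
      (doublingWealth_eq hT hj hmin (k + 1) (by omega)).symm⟩)
  · filter_upwards [hone] with ω hω
    exact zero_le_one.trans hω
  · have : ∀ᵐ ω ∂P, ω ∈ {ω | 0 < limsup (fun k => doublingWealth hT.le S c k ω) atTop} := by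
      filter_upwards [hone] with ω hω
      exact zero_lt_one.trans_le hω
    refine pos_iff_ne_zero.2 fun h0 => ?_
    obtain ⟨ω, h1, h2⟩ := (this.and (measure_eq_zero_iff_ae_notMem.1 h0)).exists
    exact h2 h1

end Doubling

/-! ### The threshold is almost surely reached -/

/-- The thresholds `exp (σ √(T 2^{-k})) - 1`. -/
noncomputable def doublingThreshold (T σ : ℝ) (k : ℕ) : ℝ :=
  Real.exp (σ * √(T * (1 / 2) ^ k)) - 1

theorem doublingThreshold_pos (hT : 0 < T) {σ : ℝ} (hσ : 0 < σ) (k : ℕ) :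
    0 < doublingThreshold T σ k :=
  sub_pos.2 (Real.one_lt_exp_iff.2 (by positivity))

theorem price_pos {s₀ : ℝ} (hs₀ : 0 < s₀) (μ σ : ℝ) (W : Time T → Ω → ℝ) (t : Time T) (ω : Ω) :
    0 < price s₀ μ σ W t ω := mul_pos hs₀ (Real.exp_pos _)

theorem doublingTime_succ_sub (hT : 0 ≤ T) (k : ℕ) :
    (doublingTime hT (k + 1) : ℝ) - doublingTime hT k = T * (1 / 2) ^ (k + 1) := by
  simp only [doublingTime]
  ring

theorem mem_winSet_of_increment (hT : 0 < T) {s₀ μ σ : ℝ} (hs₀ : 0 < s₀) (hσ : 0 < σ)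
    {W : Time T → Ω → ℝ} {k : ℕ} {ω : Ω}
    (h : (1 + |μ - σ ^ 2 / 2| * √T / σ) * √(T * (1 / 2) ^ (k + 1)) ≤
      W (doublingTime hT.le (k + 1)) ω - W (doublingTime hT.le k) ω) :
    ω ∈ winSet hT.le (price s₀ μ σ W) (doublingThreshold T σ) k := by
  have hd := doublingTime_succ_sub hT.le k
  set s := doublingTime hT.le k
  set t := doublingTime hT.le (k + 1)
  set δ := T * (1 / 2 : ℝ) ^ (k + 1)
  have hδ : 0 ≤ δ := by positivity
  have hδT : δ ≤ T := mul_le_of_le_one_right hT.le (pow_le_one₀ (by norm_num) (by norm_num))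
  have hratio : price s₀ μ σ W t ω = price s₀ μ σ W s ω *
      Real.exp ((μ - σ ^ 2 / 2) * δ + σ * (W t ω - W s ω)) := by
    rw [price, price, mul_assoc, ← Real.exp_add, ← hd]
    congr 2
    ring
  have hs := price_pos hs₀ μ σ W s ω
  change doublingThreshold T σ (k + 1) ≤ (price s₀ μ σ W t ω - price s₀ μ σ W s ω) /
    price s₀ μ σ W s ω
  rw [hratio, sub_div, mul_div_cancel_left₀ _ hs.ne', div_self hs.ne', doublingThreshold]
  refine sub_le_sub_right (Real.exp_le_exp.2 ?_) 1
  change σ * √δ ≤ _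
  have h1 := mul_le_mul_of_nonneg_left h hσ.le
  have h2 : σ * ((1 + |μ - σ ^ 2 / 2| * √T / σ) * √δ) =
      σ * √δ + |μ - σ ^ 2 / 2| * (√T * √δ) := by
    field_simp
  have h3 : δ ≤ √T * √δ := by
    calc δ = √δ * √δ := (Real.mul_self_sqrt hδ).symm
      _ ≤ √T * √δ := mul_le_mul_of_nonneg_right (Real.sqrt_le_sqrt hδT) (Real.sqrt_nonneg _)
  have h4 : -(|μ - σ ^ 2 / 2| * (√T * √δ)) ≤ (μ - σ ^ 2 / 2) * δ := by
    have h5 := mul_le_mul_of_nonneg_left h3 (abs_nonneg (μ - σ ^ 2 / 2))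
    have h6 := mul_le_mul_of_nonneg_right (neg_abs_le (μ - σ ^ 2 / 2)) hδ
    linarith
  linarith

theorem gaussianReal_Ici_pos (a : ℝ) : 0 < gaussianReal 0 1 (Set.Ici a) := by
  rw [pos_iff_ne_zero]
  intro h
  have := gaussianReal_absolutelyContinuous' 0 one_ne_zero h
  simp at this

theorem measure_increment_ge {P : Measure Ω} (hT : 0 < T) {W : Time T → Ω → ℝ}
    (hB : IsBrownianMotion P hT.le W) (a : ℝ) (k : ℕ) :
    P {ω | a * √(T * (1 / 2) ^ (k + 1)) ≤
      W (doublingTime hT.le (k + 1)) ω - W (doublingTime hT.le k) ω} =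
      gaussianReal 0 1 (Set.Ici a) := by
  set δ := T * (1 / 2 : ℝ) ^ (k + 1) with hδ
  have hδpos : 0 < δ := by positivity
  have hmap := hB.map_increment ((strictMono_doublingTime hT).monotone k.le_succ)
  rw [doublingTime_succ_sub hT.le k, ← hδ] at hmap
  have hm : Measurable fun ω => W (doublingTime hT.le (k + 1)) ω - W (doublingTime hT.le k) ω :=
    (hB.measurable _).sub (hB.measurable _)
  have hscale := gaussianReal_map_const_mul (μ := 0) (v := 1) √δ
  have hvar : NNReal.mk (√δ ^ 2) (sq_nonneg _) * 1 = δ.toNNReal := by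
    rw [mul_one]
    refine NNReal.coe_injective ?_
    rw [Real.coe_toNNReal _ hδpos.le]
    exact Real.sq_sqrt hδpos.le
  rw [hvar, mul_zero, ← hmap] at hscale
  change P ((fun ω => W (doublingTime hT.le (k + 1)) ω - W (doublingTime hT.le k) ω) ⁻¹'
    Set.Ici (a * √δ)) = _
  rw [← Measure.map_apply hm measurableSet_Ici, ← hscale,
    Measure.map_apply (by fun_prop) measurableSet_Ici]
  congr 1
  ext x
  simp only [Set.mem_preimage, Set.mem_Ici]
  rw [mul_comm a, mul_le_mul_iff_right₀ (Real.sqrt_pos.2 hδpos)]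

theorem ae_exists_mem_winSet {P : Measure Ω} [IsProbabilityMeasure P] (hT : 0 < T) {s₀ μ σ : ℝ}
    (hs₀ : 0 < s₀) (hσ : 0 < σ) {W : Time T → Ω → ℝ} (hB : IsBrownianMotion P hT.le W) :
    ∀ᵐ ω ∂P, ∃ k, ω ∈ winSet hT.le (price s₀ μ σ W) (doublingThreshold T σ) k := by
  set a := 1 + |μ - σ ^ 2 / 2| * √T / σ
  set A : ℕ → Set Ω := fun k => {ω | a * √(T * (1 / 2) ^ (k + 1)) ≤
      W (doublingTime hT.le (k + 1)) ω - W (doublingTime hT.le k) ω}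
  have hAm : ∀ k, MeasurableSet (A k) := fun k =>
    measurableSet_le measurable_const ((hB.measurable _).sub (hB.measurable _))
  have hind : iIndepSet A P := by
    rw [iIndepSet_iff_meas_biInter hAm]
    intro s
    exact (hB.hasIndepIncrements.nat (strictMono_doublingTime hT).monotone).meas_biInter
      fun k _ => ⟨Set.Ici (a * √(T * (1 / 2) ^ (k + 1))), measurableSet_Ici, rfl⟩
  have hsum : ∑' k, P (A k) = ⊤ := by
    have : ∀ k, P (A k) = gaussianReal 0 1 (Set.Ici a) := measure_increment_ge hT hB a
    simp_rw [this]
    exact ENNReal.tsum_const_eq_top_of_ne_zero (gaussianReal_Ici_pos a).ne'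
  have hlim := measure_limsup_eq_one hAm hind hsum
  have hae : ∀ᵐ ω ∂P, ω ∈ limsup A atTop := by
    rw [← mem_ae_iff_prob_eq_one (MeasurableSet.measurableSet_limsup hAm)] at hlim
    exact hlim
  filter_upwards [hae] with ω hω
  rw [mem_limsup_iff_frequently_mem] at hω
  obtain ⟨k, hk⟩ := hω.exists
  exact ⟨k, mem_winSet_of_increment hT hs₀ hσ hk⟩

end BlackScholes

open BlackScholes in
theorem mainTheorem7 {Ω : Type*} {m : MeasurableSpace Ω} (P : Measure Ω)
    [IsProbabilityMeasure P] [P.IsComplete]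
    (T : ℝ) (hT : 0 < T) (s₀ μ σ : ℝ) (hs₀ : 0 < s₀) (hσ : 0 < σ)
    (W : Time T → Ω → ℝ) (hW : IsBrownianMotion P hT.le W)
    (S : Time T → Ω → ℝ) (hS : S = price s₀ μ σ W)
    (𝓕 : Filtration (Time T) m) (h𝓕 : 𝓕 = priceFiltration P s₀ μ σ W hW.measurable) :
    -- no arbitrage with simple strategies
    (∀ Φ ∈ simple P 𝓕 hT.le S, ¬ Φ.IsArbitrage P hT.le S) ∧
    -- strong approximate arbitrage with simple strategies
    (∃ Ψ : ℕ → Portfolio 𝓕, (∀ n, Ψ n ∈ simple P 𝓕 hT.le S) ∧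
      IsStrongApproximateArbitrage Ψ P hT.le S) ∧
    -- strong arbitrage with almost simple strategies
    (∃ Φ ∈ almostSimple P 𝓕 hT.le S, Φ.IsStrongArbitrage P hT.le S) ∧
    -- both are realized by a doubling strategy along `T (1 - 2 ^ (-k))` and its truncations
    (∃ c : ℕ → ℝ, (∀ k, 0 < c k) ∧
      ∃ Φ ∈ almostSimple P 𝓕 hT.le S, ∃ Ψ : ℕ → Portfolio 𝓕,
        (∀ n, Ψ n ∈ simple P 𝓕 hT.le S) ∧
        Φ.IsDoubling P hT.le S c ∧
        (∀ n, (Ψ n).IsTruncatedDoubling Φ P hT.le S c n) ∧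
        IsStrongApproximateArbitrage Ψ P hT.le S ∧
        Φ.IsStrongArbitrage P hT.le S) := by
  subst hS h𝓕
  have hc := doublingThreshold_pos hT hσ
  have hwin := ae_exists_mem_winSet hT (μ := μ) hs₀ hσ hW
  have hpos := price_pos hs₀ μ σ W
  have hS : Adapted (priceFiltration P s₀ μ σ W hW.measurable) (price s₀ μ σ W) := adapted_price
  have hΨ := truncatedPortfolio_mem_simple (P := P) hT hS (doublingThreshold T σ)
  have hΨa := truncatedPortfolio_isStrongApproximateArbitrage hT hS hpos hc hwin
  have hΦ := doublingPortfolio_mem_almostSimple hT hS hwin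
  have hΦa := doublingPortfolio_isStrongArbitrage hT hS hpos hc hwin
  exact ⟨fun Φ hΦ => not_isArbitrage_of_mem_simple hT hW hσ.ne' hΦ, ⟨_, hΨ, hΨa⟩, ⟨_, hΦ, hΦa⟩,
    _, hc, _, hΦ, _, hΨ, doublingPortfolio_isDoubling hT hS hwin,
    truncatedPortfolio_isTruncatedDoubling hT hS hwin, hΨa, hΦa⟩
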